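/- **Setting.** Let $n\ge 1$. All functions are complex-valued and measurable on $\mathbb R^n$ (identified when equal a.e.). Vectors of exponents are $\vec p=(p_1,\dots,p_n)$, $\vec s=(s_1,\dots,s_n)$; relations between vectors are meant coordinatewise, $1/\infty=0$, and $\vec p\,',\vec s\,',\alpha'$ denote the conjugate exponents ($\frac1{p_i}+\frac1{p_i'}=1$, etc.). Put $$\|f\|_{L^{\vec p}}=\Big(\int_{\mathbb R}\cdots\Big(\int_{\mathbb R}|f(x)|^{p_1}dx_1\Big)^{p_2/p_1}\cdots dx_n\Big)^{1/p_n},\qquad \|a\|_{\ell^{\vec s}}=\Big(\sum_{k_n\in\mathbb Z}\cdots\Big(\sum_{k_1\in\mathbb Z}|a_k|^{s_1}\Big)^{s_2/s_1}\cdots\Big)^{1/s_n},$$ with (essential) suprema in place of the integrals or sums for infinite exponents. For $r>0$, $k\in\mathbb Z^n$ let $Q_{r,k}=r(k+[0,1)^n)$ and ${}_r\|f\|_{\vec p,\vec s}=\big\|\{\|f\chi_{Q_{r,k}}\|_{L^{\vec p}}\}_{k\in\mathbb Z^n}\big\|_{\ell^{\vec s}}$. Let $(L^{\vec p},\ell^{\vec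 s})$ be the space of $f\in L^1_{loc}(\mathbb R^n)$ with $\|f\|_{\vec p,\vec s}:={}_1\|f\|_{\vec p,\vec s}<\infty$, and $(L^{\vec p},\ell^{\vec s})^\alpha$ the space of $f\in L^1_{loc}(\mathbb R^n)$ with $$\|f\|_{(L^{\vec p},\ell^{\vec s})^\alpha}:=\sup_{r>0} r^{\frac n\alpha-\sum_{i=1}^n\frac1{p_i}}\;{}_r\|f\|_{\vec p,\vec s}<\infty .$$ Let $St^{(\beta)}_r f(x)=r^{-n/\beta}f(r^{-1}x)$. The block space $\mathcal H(\vec p\,',\vec s\,',\alpha')$ consists of all $f\in L^1_{loc}(\mathbb R^n)$ having a block decomposition, that is, a sequence $(c_j,r_j,f_j)_{j\ge1}$ in $\mathbb C\times(0,\infty)\times(L^{\vec p\,'},\ell^{\vec s\,'})$ with $\|f_j\|_{\vec p\,',\vec s\,'}\le1$ for all $j$, $\sum_j|c_j|<\infty$, and $f=\sum_j c_j St^{(\alpha')}_{r_j}f_j$ with convergence in $L^1_{loc}(\mathbb R^n)$; $\|f\|_{\mathcal H(\vec p\,',\vec s\,',\alpha')}$ is the infimum of $\sum_j|c_j|$ over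 all block decompositions of $f$. **Theorem 2.7.** Let $1\le\vec p,\vec s\le\infty$ and $\frac1n\sum_{i=1}^n\frac1{s_i}\le\frac1\alpha\le\frac1n\sum_{i=1}^n\frac1{p_i}$. (i) If $g\in(L^{\vec p},\ell^{\vec s})^\alpha$ and $f\in\mathcal H(\vec p\,',\vec s\,',\alpha')$, then $fg\in L^1(\mathbb R^n)$ and $$\Big|\int_{\mathbb R^n}f(x)g(x)\,dx\Big|\le\|g\|_{(L^{\vec p},\ell^{\vec s})^\alpha}\,\|f\|_{\mathcal H(\vec p\,',\vec s\,',\alpha')}.$$ (ii) If moreover $1<\vec p,\vec s\le\infty$, then the operator $T:g\mapsto T_g$, $\langle T_g,f\rangle=\int_{\mathbb R^n}f(x)g(x)\,dx$ for $g\in(L^{\vec p},\ell^{\vec s})^\alpha$ and $f\in\mathcal H(\vec p\,',\vec s\,',\alpha')$, is a linear isometric isomorphism of $(L^{\vec p},\ell^{\vec s})^\alpha$ onto the dual space $\mathcal H(\vec p\,',\vec s\,',\alpha')^*$. -/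

import Mathlib

open MeasureTheory Filter Topology
open scoped ENNReal

namespace MixedAmalgam

/-- The iterated (mixed) norm of a nonnegative function of `n` variables, the first variable being
the innermost one:
`‖ ⋯ ‖ ‖F(x₁, …, xₙ)‖_{L^{p₁}(dμ(x₁))} ‖_{L^{p₂}(dμ(x₂))} ⋯ ‖_{L^{pₙ}(dμ(xₙ))}`,
where an exponent `∞` means the essential supremum. With `X = ℝ` and Lebesgue measure this is the
norm of `L^{p⃗}(ℝⁿ)`; with `X = ℤ` and counting measure it is the norm of `ℓ^{p⃗}(ℤⁿ)`. -/
noncomputable def mixedENorm {X : Type} [MeasurableSpace X] (μ : Measure X) :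
    {n : ℕ} → (Fin n → ℝ≥0∞) → ((Fin n → X) → ℝ≥0∞) → ℝ≥0∞
  | 0, _, F => F Fin.elim0
  | _ + 1, p, F =>
      mixedENorm μ (fun i => p i.succ)
        (fun y => eLpNorm (fun t => F (Fin.cons t y)) (p 0) μ)

section mixed
variable {X : Type} [MeasurableSpace X] {μ : Measure X}

theorem measurable_cons {n : ℕ} :
    Measurable (fun z : (Fin n → X) × X => (Fin.cons z.2 z.1 : Fin (n + 1) → X)) := by
  refine measurable_pi_iff.2 fun i => ?_
  refine Fin.cases ?_ (fun j => ?_) i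
  · simpa using measurable_snd
  · simpa using (show Measurable fun z : (Fin n → X) × X => z.1 j by fun_prop)

theorem measurable_eLpNorm_slice [SFinite μ] {Y : Type} [MeasurableSpace Y]
    {F : Y × X → ℝ≥0∞} (hF : Measurable F) (q : ℝ≥0∞) :
    Measurable fun y => eLpNorm (fun t => F (y, t)) q μ := by
  by_cases h0 : q = 0
  · simp [h0]
  by_cases ht : q = ∞
  · subst ht
    refine measurable_of_Ioi fun c => ?_
    have hset : (fun y => eLpNorm (fun t => F (y, t)) ∞ μ) ⁻¹' Set.Ioi c
        = {y | μ (Prod.mk y ⁻¹' {z | c < F z}) ≠ 0} := by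
      ext y
      simp only [Set.mem_preimage, Set.mem_Ioi, Set.mem_ofPred_eq, eLpNorm_exponent_top,
        eLpNormEssSup_eq_essSup_enorm, enorm_eq_self]
      rw [← not_le, not_iff_not]
      constructor
      · intro h
        have : ∀ᵐ t ∂μ, F (y, t) ≤ c := (ENNReal.ae_le_essSup _).mono fun t ht => ht.trans h
        rw [ae_iff] at this
        simpa using this
      · intro h
        refine essSup_le_of_ae_le _ ?_
        rw [Filter.EventuallyLE, ae_iff]
        simpa using h
    rw [hset]
    exact (measurable_measure_prodMk_left (measurableSet_lt measurable_const hF))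
      (measurableSet_singleton 0).compl
  · simp only [eLpNorm_eq_lintegral_rpow_enorm_toReal h0 ht, enorm_eq_self]
    exact (Measurable.lintegral_prod_right' (hF.pow_const _)).pow_const _

theorem measurable_inner [SFinite μ] {n : ℕ} {F : (Fin (n + 1) → X) → ℝ≥0∞} (hF : Measurable F)
    (q : ℝ≥0∞) : Measurable fun y : Fin n → X => eLpNorm (fun t => F (Fin.cons t y)) q μ :=
  measurable_eLpNorm_slice (hF.comp measurable_cons) q

theorem mixedENorm_mono {n : ℕ} (p : Fin n → ℝ≥0∞) {F G : (Fin n → X) → ℝ≥0∞} (h : F ≤ G) :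
    mixedENorm μ p F ≤ mixedENorm μ p G := by
  induction n with
  | zero => exact h _
  | succ n ih =>
    refine ih _ fun y => eLpNorm_mono_enorm fun t => ?_
    simpa using h _

theorem mixedENorm_add_le [SFinite μ] {n : ℕ} {p : Fin n → ℝ≥0∞} (hp : ∀ i, 1 ≤ p i)
    {F G : (Fin n → X) → ℝ≥0∞} (hF : Measurable F) (hG : Measurable G) :
    mixedENorm μ p (F + G) ≤ mixedENorm μ p F + mixedENorm μ p G := by
  induction n with
  | zero => exact le_rfl
  | succ n ih =>
    refine (mixedENorm_mono (fun i => p i.succ) ?_).trans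
      (ih (fun i => hp i.succ) (measurable_inner hF (p 0)) (measurable_inner hG (p 0)))
    intro y
    have hc : Measurable fun t : X => (Fin.cons t y : Fin (n + 1) → X) :=
      measurable_cons.comp (measurable_const.prodMk measurable_id)
    exact eLpNorm_add_le (hF.comp hc).aestronglyMeasurable (hG.comp hc).aestronglyMeasurable (hp 0)

theorem eLpNorm_const_mul_ennreal {c : ℝ≥0∞} (hc : c ≠ ∞) (G : X → ℝ≥0∞) (q : ℝ≥0∞) :
    eLpNorm (fun t => c * G t) q μ = c * eLpNorm G q μ := by
  by_cases h0 : q = 0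
  · simp [h0]
  by_cases ht : q = ∞
  · subst ht
    simp only [eLpNorm_exponent_top, eLpNormEssSup_eq_essSup_enorm, enorm_eq_self]
    exact ENNReal.essSup_const_mul
  · have hq := ENNReal.toReal_pos h0 ht
    simp only [eLpNorm_eq_lintegral_rpow_enorm_toReal h0 ht, enorm_eq_self,
      ENNReal.mul_rpow_of_nonneg _ _ hq.le]
    rw [lintegral_const_mul' _ _ (ENNReal.rpow_ne_top_of_nonneg hq.le hc),
      ENNReal.mul_rpow_of_nonneg _ _ (by positivity), ← ENNReal.rpow_mul,
      mul_one_div_cancel hq.ne', ENNReal.rpow_one]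

theorem mixedENorm_const_mul {n : ℕ} (p : Fin n → ℝ≥0∞) {c : ℝ≥0∞} (hc : c ≠ ∞)
    (F : (Fin n → X) → ℝ≥0∞) :
    mixedENorm μ p (fun x => c * F x) = c * mixedENorm μ p F := by
  induction n with
  | zero => rfl
  | succ n ih =>
    simp only [mixedENorm, eLpNorm_const_mul_ennreal hc, ih]

theorem ae_slice [SigmaFinite μ] {n : ℕ} {P : (Fin (n + 1) → X) → Prop}
    (h : ∀ᵐ x ∂(Measure.pi fun _ : Fin (n + 1) => μ), P x) :
    ∀ᵐ y ∂(Measure.pi fun _ : Fin n => μ), ∀ᵐ t ∂μ, P (Fin.cons t y) := by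
  have h1 := ((measurePreserving_piFinSuccAbove (fun _ : Fin (n + 1) => μ) 0).symm).quasiMeasurePreserving.ae h
  have h2 := Measure.ae_ae_of_ae_prod
    ((Measure.measurePreserving_swap (μ := Measure.pi fun _ : Fin n => μ)
      (ν := μ)).quasiMeasurePreserving.ae h1)
  filter_upwards [h2] with y hy
  filter_upwards [hy] with t ht
  simpa [MeasurableEquiv.piFinSuccAbove_symm_apply, Fin.insertNthEquiv, Fin.insertNth_zero] using ht

theorem mixedENorm_congr_ae [SigmaFinite μ] {n : ℕ} (p : Fin n → ℝ≥0∞)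
    {F G : (Fin n → X) → ℝ≥0∞} (h : F =ᵐ[Measure.pi fun _ => μ] G) :
    mixedENorm μ p F = mixedENorm μ p G := by
  induction n with
  | zero =>
    rw [Measure.pi_of_empty _ Fin.elim0] at h
    simp only [ae_dirac_eq] at h
    exact eventually_pure.1 h
  | succ n ih =>
    refine ih _ ?_
    filter_upwards [ae_slice h] with y hy
    exact eLpNorm_congr_ae hy

theorem ae_eq_zero_of_mixedENorm_eq_zero [SigmaFinite μ] {n : ℕ} {p : Fin n → ℝ≥0∞}
    (hp : ∀ i, 1 ≤ p i) {F : (Fin n → X) → ℝ≥0∞} (hF : Measurable F)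
    (h : mixedENorm μ p F = 0) : F =ᵐ[Measure.pi fun _ => μ] 0 := by
  induction n with
  | zero =>
    refine Eventually.of_forall fun x => ?_
    rw [Subsingleton.elim x Fin.elim0]
    exact h
  | succ n ih =>
    have h1 := ih (fun i => hp i.succ) (measurable_inner hF (p 0)) h
    have hs : MeasurableSet {z : (Fin n → X) × X | F (Fin.cons z.2 z.1) = 0} :=
      (hF.comp measurable_cons) (measurableSet_singleton 0)
    have h2 : ∀ᵐ z ∂((Measure.pi fun _ : Fin n => μ).prod μ), F (Fin.cons z.2 z.1) = 0 := by
      rw [Measure.ae_prod_iff_ae_ae hs]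
      filter_upwards [h1] with y hy
      have hc : Measurable fun t : X => (Fin.cons t y : Fin (n + 1) → X) :=
        measurable_cons.comp (measurable_const.prodMk measurable_id)
      exact (eLpNorm_eq_zero_iff (hF.comp hc).aestronglyMeasurable
        (zero_lt_one.trans_le (hp 0)).ne').1 hy
    have h3 := (Measure.measurePreserving_swap (μ := μ)
      (ν := Measure.pi fun _ : Fin n => μ)).quasiMeasurePreserving.ae h2
    have h4 := (measurePreserving_piFinSuccAbove (fun _ : Fin (n + 1) => μ) 0).quasiMeasurePreserving.ae h3
    filter_upwards [h4] with x hx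
    simpa [MeasurableEquiv.piFinSuccAbove, Fin.insertNthEquiv, Fin.removeNth, Fin.cons_self_tail] using hx

end mixed

variable {n : ℕ}

/-- The cube `Q_{r,k} = r (k + [0,1)ⁿ)`. -/
def cube (r : ℝ) (k : Fin n → ℤ) : Set (Fin n → ℝ) :=
  {x | ∀ i, r * k i ≤ x i ∧ x i < r * (k i + 1)}

/-- The quantity `‖ { ‖f χ_{Q_{r,k}}‖_{L^{p⃗}} }_{k ∈ ℤⁿ} ‖_{ℓ^{s⃗}}`. For `r = 1` it is the norm of the
amalgam space `(L^{p⃗}, ℓ^{s⃗})(ℝⁿ)`. -/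
noncomputable def scaledENorm (r : ℝ) (p s : Fin n → ℝ≥0∞) (f : (Fin n → ℝ) → ℂ) : ℝ≥0∞ :=
  mixedENorm Measure.count s fun k : Fin n → ℤ =>
    mixedENorm volume p fun x => ‖(cube r k).indicator f x‖ₑ

/-- The norm of `(L^{p⃗}, ℓ^{s⃗})^α(ℝⁿ)`: the supremum over `r > 0` of
`r^{n/α - ∑ 1/pᵢ} ‖ { ‖f χ_{Q_{r,k}}‖_{L^{p⃗}} }_k ‖_{ℓ^{s⃗}}` (with `1/∞ = 0`). -/
noncomputable def fofanaENorm (p s : Fin n → ℝ≥0∞) (α : ℝ≥0∞) (f : (Fin n → ℝ) → ℂ) : ℝ≥0∞ :=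
  ⨆ (r : ℝ) (_ : 0 < r),
    ENNReal.ofReal (r ^ ((n : ℝ) * α⁻¹.toReal - ∑ i, (p i)⁻¹.toReal)) * scaledENorm r p s f

theorem measurableSet_cube (r : ℝ) (k : Fin n → ℤ) : MeasurableSet (cube r k) := by
  have : cube r k = ⋂ i, (fun x : Fin n → ℝ => x i) ⁻¹' Set.Ico (r * k i) (r * (k i + 1)) := by
    ext x; simp [cube]
  rw [this]
  exact MeasurableSet.iInter fun i => measurable_pi_apply i measurableSet_Ico

theorem scaledENorm_congr_ae (r : ℝ) (p s : Fin n → ℝ≥0∞) {f g : (Fin n → ℝ) → ℂ}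
    (h : f =ᵐ[volume] g) : scaledENorm r p s f = scaledENorm r p s g := by
  unfold scaledENorm
  congr 1
  funext k
  refine mixedENorm_congr_ae p ?_
  filter_upwards [h] with x hx
  simp [Set.indicator, hx]

theorem scaledENorm_add_le (r : ℝ) {p s : Fin n → ℝ≥0∞} (hp : ∀ i, 1 ≤ p i) (hs : ∀ i, 1 ≤ s i)
    {f g : (Fin n → ℝ) → ℂ} (hf : Measurable f) (hg : Measurable g) :
    scaledENorm r p s (f + g) ≤ scaledENorm r p s f + scaledENorm r p s g := by
  refine (mixedENorm_mono s fun k => ?_).trans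
    (mixedENorm_add_le hs (Measurable.of_discrete) (Measurable.of_discrete))
  refine (mixedENorm_mono p fun x => ?_).trans (mixedENorm_add_le hp
    (hf.indicator (measurableSet_cube r k)).enorm (hg.indicator (measurableSet_cube r k)).enorm)
  rw [Set.indicator_add']
  exact enorm_add_le _ _

theorem scaledENorm_smul (r : ℝ) (p s : Fin n → ℝ≥0∞) (c : ℂ) (f : (Fin n → ℝ) → ℂ) :
    scaledENorm r p s (c • f) = ‖c‖ₑ * scaledENorm r p s f := by
  unfold scaledENorm
  rw [← mixedENorm_const_mul s enorm_ne_top]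
  congr 1
  funext k
  rw [← mixedENorm_const_mul p enorm_ne_top]
  congr 1
  funext x
  rw [← enorm_mul, ← smul_eq_mul]
  congr 1
  exact Set.indicator_const_smul_apply (cube r k) c f x

theorem ae_eq_zero_of_scaledENorm_eq_zero {p s : Fin n → ℝ≥0∞} (hp : ∀ i, 1 ≤ p i)
    (hs : ∀ i, 1 ≤ s i) {f : (Fin n → ℝ) → ℂ} (hf : Measurable f)
    (h : scaledENorm 1 p s f = 0) : f =ᵐ[volume] 0 := by
  have h1 := ae_eq_zero_of_mixedENorm_eq_zero hs Measurable.of_discrete h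
  have h2 : ∀ k : Fin n → ℤ, ∀ᵐ x : Fin n → ℝ, (cube 1 k).indicator f x = 0 := by
    intro k
    have hk : mixedENorm volume p (fun x => ‖(cube 1 k).indicator f x‖ₑ) = 0 := by
      by_contra hne
      have h3 := measure_mono_null (Set.singleton_subset_iff.2 hne) (ae_iff.1 h1)
      simp [Measure.pi_singleton] at h3
    filter_upwards [ae_eq_zero_of_mixedENorm_eq_zero hp
      (hf.indicator (measurableSet_cube 1 k)).enorm hk] with x hx
    simpa using hx
  filter_upwards [ae_all_iff.2 h2] with x hx
  have hm : x ∈ cube 1 (fun i => ⌊x i⌋) := fun i => by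
    simpa only [one_mul] using And.intro (Int.floor_le (x i)) (Int.lt_floor_add_one (x i))
  simpa [Set.indicator_of_mem hm] using hx fun i => ⌊x i⌋

theorem fofanaENorm_congr_ae (p s : Fin n → ℝ≥0∞) (α : ℝ≥0∞) {f g : (Fin n → ℝ) → ℂ}
    (h : f =ᵐ[volume] g) : fofanaENorm p s α f = fofanaENorm p s α g := by
  unfold fofanaENorm
  simp only [scaledENorm_congr_ae _ p s h]

theorem fofanaENorm_add_le {p s : Fin n → ℝ≥0∞} (hp : ∀ i, 1 ≤ p i) (hs : ∀ i, 1 ≤ s i)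
    (α : ℝ≥0∞) {f g : (Fin n → ℝ) → ℂ} (hf : Measurable f) (hg : Measurable g) :
    fofanaENorm p s α (f + g) ≤ fofanaENorm p s α f + fofanaENorm p s α g := by
  refine iSup₂_le fun r hr => ?_
  refine (mul_le_mul_right (scaledENorm_add_le r hp hs hf hg) _).trans ?_
  rw [mul_add]
  exact add_le_add
    (le_iSup₂ (f := fun (r : ℝ) (_ : 0 < r) => ENNReal.ofReal
      (r ^ ((n : ℝ) * α⁻¹.toReal - ∑ i, (p i)⁻¹.toReal)) * scaledENorm r p s f) r hr)
    (le_iSup₂ (f := fun (r : ℝ) (_ : 0 < r) => ENNReal.ofReal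
      (r ^ ((n : ℝ) * α⁻¹.toReal - ∑ i, (p i)⁻¹.toReal)) * scaledENorm r p s g) r hr)

theorem fofanaENorm_smul (p s : Fin n → ℝ≥0∞) (α : ℝ≥0∞) (c : ℂ) (f : (Fin n → ℝ) → ℂ) :
    fofanaENorm p s α (c • f) = ‖c‖ₑ * fofanaENorm p s α f := by
  unfold fofanaENorm
  simp only [scaledENorm_smul, ENNReal.mul_iSup]
  simp only [mul_left_comm]

theorem scaledENorm_one_le_fofanaENorm (p s : Fin n → ℝ≥0∞) (α : ℝ≥0∞) (f : (Fin n → ℝ) → ℂ) :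
    scaledENorm 1 p s f ≤ fofanaENorm p s α f := by
  refine le_trans (by simp) (le_iSup₂ (1 : ℝ) one_pos)

section fofana
variable (p s : Fin n → ℝ≥0∞) (α : ℝ≥0∞) [hp : Fact (∀ i, 1 ≤ p i)] [hs : Fact (∀ i, 1 ≤ s i)]

/-- The space `(L^{p⃗}, ℓ^{s⃗})^α(ℝⁿ)` of (almost everywhere classes of) locally integrable functions
with finite norm. -/
noncomputable def FofanaSpace : Submodule ℂ ((Fin n → ℝ) →ₘ[volume] ℂ) where
  carrier := {u | LocallyIntegrable (⇑u) ∧ fofanaENorm p s α u < ∞}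
  zero_mem' := by
    refine ⟨(locallyIntegrable_zero).congr AEEqFun.coeFn_zero.symm, ?_⟩
    have h0 : fofanaENorm p s α (0 : (Fin n → ℝ) → ℂ) = 0 := by
      simpa using fofanaENorm_smul p s α 0 0
    rw [fofanaENorm_congr_ae p s α AEEqFun.coeFn_zero, h0]
    exact ENNReal.zero_lt_top
  add_mem' := by
    rintro u v ⟨hu, hu'⟩ ⟨hv, hv'⟩
    refine ⟨(hu.add hv).congr (AEEqFun.coeFn_add u v).symm, ?_⟩
    rw [fofanaENorm_congr_ae p s α (AEEqFun.coeFn_add u v)]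
    exact (fofanaENorm_add_le hp.out hs.out α u.measurable v.measurable).trans_lt
      (ENNReal.add_lt_top.2 ⟨hu', hv'⟩)
  smul_mem' := by
    rintro c u ⟨hu, hu'⟩
    refine ⟨(hu.smul c).congr (AEEqFun.coeFn_smul c u).symm, ?_⟩
    rw [fofanaENorm_congr_ae p s α (AEEqFun.coeFn_smul c u), fofanaENorm_smul]
    exact ENNReal.mul_lt_top enorm_lt_top hu'

noncomputable instance : Norm (FofanaSpace p s α) where
  norm u := (fofanaENorm p s α u).toReal

theorem fofanaSpace_core : NormedSpace.Core ℂ (FofanaSpace p s α) where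
  norm_nonneg u := ENNReal.toReal_nonneg
  norm_smul c u := by
    change (fofanaENorm p s α ((c • (u : (Fin n → ℝ) →ₘ[volume] ℂ) : (Fin n → ℝ) →ₘ[volume] ℂ))).toReal
      = ‖c‖ * (fofanaENorm p s α u).toReal
    rw [fofanaENorm_congr_ae p s α (AEEqFun.coeFn_smul c u.1), fofanaENorm_smul]
    simp
  norm_triangle u v := by
    change (fofanaENorm p s α (((u : (Fin n → ℝ) →ₘ[volume] ℂ) + v : (Fin n → ℝ) →ₘ[volume] ℂ))).toReal
      ≤ (fofanaENorm p s α u).toReal + (fofanaENorm p s α v).toReal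
    rw [fofanaENorm_congr_ae p s α (AEEqFun.coeFn_add u.1 v.1),
      ← ENNReal.toReal_add u.2.2.ne v.2.2.ne]
    exact ENNReal.toReal_mono (ENNReal.add_ne_top.2 ⟨u.2.2.ne, v.2.2.ne⟩)
      (fofanaENorm_add_le hp.out hs.out α u.1.measurable v.1.measurable)
  norm_eq_zero_iff u := by
    constructor
    · intro h
      have h0 : fofanaENorm p s α u = 0 :=
        ((ENNReal.toReal_eq_zero_iff _).1 h).resolve_right u.2.2.ne
      have h1 := ae_eq_zero_of_scaledENorm_eq_zero hp.out hs.out u.1.measurable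
        (le_antisymm ((scaledENorm_one_le_fofanaENorm p s α u).trans h0.le) zero_le)
      exact Subtype.ext (AEEqFun.ext (h1.trans AEEqFun.coeFn_zero.symm))
    · rintro rfl
      change (fofanaENorm p s α ((0 : (Fin n → ℝ) →ₘ[volume] ℂ))).toReal = 0
      rw [fofanaENorm_congr_ae p s α AEEqFun.coeFn_zero]
      simpa using congrArg ENNReal.toReal (fofanaENorm_smul p s α 0 0)

noncomputable instance : NormedAddCommGroup (FofanaSpace p s α) :=
  NormedAddCommGroup.ofCore (fofanaSpace_core p s α)

noncomputable instance : NormedSpace ℂ (FofanaSpace p s α) :=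
  NormedSpace.ofCore (fofanaSpace_core p s α)

end fofana

/-- The dilation `St_r^{(β)} f (x) = r^{-n/β} f(r⁻¹ x)` (with `1/∞ = 0`). -/
noncomputable def dilate (β : ℝ≥0∞) (r : ℝ) (f : (Fin n → ℝ) → ℂ) : (Fin n → ℝ) → ℂ :=
  fun x => ((r ^ (-((n : ℝ) * β⁻¹.toReal)) : ℝ) : ℂ) * f (r⁻¹ • x)

/-- `(c_j, r_j, b_j)_j` is a block decomposition of `f`: the `b_j` lie in `(L^{q⃗}, ℓ^{t⃗})(ℝⁿ)` with
norm at most `1`, `∑ |c_j| < ∞`, and `f = ∑ c_j St_{r_j}^{(β)} b_j` with convergence of the partial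
sums in `L¹_loc(ℝⁿ)`, that is, in `L¹(K)` for every compact `K`. -/
structure IsBlockDecomposition (q t : Fin n → ℝ≥0∞) (β : ℝ≥0∞) (f : (Fin n → ℝ) → ℂ)
    (c : ℕ → ℂ) (r : ℕ → ℝ) (b : ℕ → (Fin n → ℝ) → ℂ) : Prop where
  pos : ∀ j, 0 < r j
  locInt : ∀ j, LocallyIntegrable (b j)
  norm_le : ∀ j, scaledENorm 1 q t (b j) ≤ 1
  summable : Summable fun j => ‖c j‖
  tendsto : ∀ K : Set (Fin n → ℝ), IsCompact K →
    Tendsto (fun J => ∫⁻ x in K, ‖f x - ∑ j ∈ Finset.range J, c j * dilate β (r j) (b j) x‖ₑ)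
      atTop (𝓝 0)


theorem aestronglyMeasurable_dilate (β : ℝ≥0∞) {r : ℝ} (hr : 0 < r) {f : (Fin n → ℝ) → ℂ}
    (hf : AEStronglyMeasurable f) : AEStronglyMeasurable (dilate β r f) :=
  (hf.comp_quasiMeasurePreserving
    (Measure.quasiMeasurePreserving_smul volume (inv_ne_zero hr.ne'))).const_mul _

theorem scaledENorm_zero (r : ℝ) (q t : Fin n → ℝ≥0∞) :
    scaledENorm r q t (0 : (Fin n → ℝ) → ℂ) = 0 := by
  simpa using scaledENorm_smul r q t 0 0

/-- The sequence `u 0, v 0, u 1, v 1, …`. -/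
def interleave {A : Type} (u v : ℕ → A) (j : ℕ) : A := if j % 2 = 0 then u (j / 2) else v (j / 2)

theorem interleave_even {A : Type} (u v : ℕ → A) (k : ℕ) : interleave u v (2 * k) = u k := by
  simp [interleave]

theorem interleave_odd {A : Type} (u v : ℕ → A) (k : ℕ) : interleave u v (2 * k + 1) = v k := by
  have h1 : (2 * k + 1) % 2 = 1 := by omega
  have h2 : (2 * k + 1) / 2 = k := by omega
  simp [interleave, h1, h2]

theorem forall_interleave {A : Type} {P : A → Prop} {u v : ℕ → A} (hu : ∀ j, P (u j))
    (hv : ∀ j, P (v j)) (j : ℕ) : P (interleave u v j) := by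
  unfold interleave
  split_ifs
  exacts [hu _, hv _]

theorem sum_range_even_odd {M : Type} [AddCommMonoid M] (w : ℕ → M) (J : ℕ) :
    ∑ j ∈ Finset.range J, w j = ∑ j ∈ Finset.range ((J + 1) / 2), w (2 * j)
      + ∑ j ∈ Finset.range (J / 2), w (2 * j + 1) := by
  induction J with
  | zero => simp
  | succ J ih =>
    rw [Finset.sum_range_succ, ih]
    obtain ⟨k, rfl | rfl⟩ := J.even_or_odd'
    · have h1 : (2 * k + 1 + 1) / 2 = k + 1 := by omega
      have h2 : (2 * k + 1) / 2 = k := by omega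
      have h3 : 2 * k / 2 = k := by omega
      rw [h1, h2, h3, Finset.sum_range_succ (fun j => w (2 * j))]
      abel
    · have h1 : (2 * k + 1 + 1 + 1) / 2 = k + 1 := by omega
      have h2 : (2 * k + 1 + 1) / 2 = k + 1 := by omega
      have h3 : (2 * k + 1) / 2 = k := by omega
      rw [h1, h2, h3, Finset.sum_range_succ (fun j => w (2 * j + 1))]
      abel

namespace IsBlockDecomposition
variable {q t : Fin n → ℝ≥0∞} {β : ℝ≥0∞} {f g : (Fin n → ℝ) → ℂ} {c c' : ℕ → ℂ} {r r' : ℕ → ℝ}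
  {b b' : ℕ → (Fin n → ℝ) → ℂ}

theorem congr_ae (h : IsBlockDecomposition q t β f c r b) (hfg : f =ᵐ[volume] g) :
    IsBlockDecomposition q t β g c r b where
  pos := h.pos
  locInt := h.locInt
  norm_le := h.norm_le
  summable := h.summable
  tendsto K hK := by
    refine (h.tendsto K hK).congr fun J => lintegral_congr_ae ?_
    filter_upwards [ae_restrict_of_ae hfg] with x hx
    rw [hx]

theorem zero : IsBlockDecomposition q t β (0 : (Fin n → ℝ) → ℂ) 0 (fun _ => 1) 0 where
  pos _ := one_pos
  locInt _ := locallyIntegrable_zero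
  norm_le _ := by
    change scaledENorm 1 q t (0 : (Fin n → ℝ) → ℂ) ≤ 1
    rw [scaledENorm_zero]
    exact zero_le
  summable := by simp
  tendsto K _ := by simp

theorem smul (h : IsBlockDecomposition q t β f c r b) (a : ℂ) :
    IsBlockDecomposition q t β (a • f) (fun j => a * c j) r b where
  pos := h.pos
  locInt := h.locInt
  norm_le := h.norm_le
  summable := by simpa using h.summable.mul_left ‖a‖
  tendsto K hK := by
    have h1 := ENNReal.Tendsto.const_mul (a := ‖a‖ₑ) (h.tendsto K hK) (Or.inr enorm_ne_top)
    rw [mul_zero] at h1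
    refine h1.congr fun J => ?_
    rw [← lintegral_const_mul' _ _ enorm_ne_top]
    refine lintegral_congr fun x => ?_
    rw [← enorm_mul, mul_sub, Finset.mul_sum]
    simp [mul_assoc]

theorem add (h : IsBlockDecomposition q t β f c r b) (h' : IsBlockDecomposition q t β g c' r' b')
    (hf : Measurable f) :
    IsBlockDecomposition q t β (f + g) (interleave c c') (interleave r r') (interleave b b') where
  pos := forall_interleave (P := fun ρ : ℝ => 0 < ρ) h.pos h'.pos
  locInt := forall_interleave (P := fun φ : (Fin n → ℝ) → ℂ => LocallyIntegrable φ) h.locInt h'.locInt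
  norm_le := forall_interleave (P := fun φ => scaledENorm 1 q t φ ≤ 1) h.norm_le h'.norm_le
  summable := by
    have h1 : HasSum (fun k => ‖interleave c c' (2 * k)‖) (∑' j, ‖c j‖) := by
      simpa only [interleave_even] using h.summable.hasSum
    have h2 : HasSum (fun k => ‖interleave c c' (2 * k + 1)‖) (∑' j, ‖c' j‖) := by
      simpa only [interleave_odd] using h'.summable.hasSum
    exact (HasSum.even_add_odd (f := fun k => ‖interleave c c' k‖) h1 h2).summable
  tendsto K hK := by
    have t1 : Tendsto (fun J : ℕ => (J + 1) / 2) atTop atTop :=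
      (Nat.tendsto_div_const_atTop two_ne_zero).comp (tendsto_add_atTop_nat 1)
    have t2 : Tendsto (fun J : ℕ => J / 2) atTop atTop := Nat.tendsto_div_const_atTop two_ne_zero
    have h1 := ((h.tendsto K hK).comp t1).add ((h'.tendsto K hK).comp t2)
    rw [add_zero] at h1
    refine tendsto_of_tendsto_of_tendsto_of_le_of_le tendsto_const_nhds h1 (fun _ => zero_le)
      fun J => ?_
    have hm : AEStronglyMeasurable (fun x => f x -
        ∑ j ∈ Finset.range ((J + 1) / 2), c j * dilate β (r j) (b j) x) :=
      hf.aestronglyMeasurable.sub (Finset.aestronglyMeasurable_fun_sum _ fun j _ =>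
        (aestronglyMeasurable_dilate β (h.pos j) (h.locInt j).aestronglyMeasurable).const_mul _)
    simp only [Function.comp]
    rw [← lintegral_add_left' hm.enorm.restrict]
    refine lintegral_mono fun x => ?_
    simp only [Pi.add_apply]
    rw [sum_range_even_odd]
    simp only [interleave_even, interleave_odd]
    rw [add_sub_add_comm]
    exact enorm_add_le _ _

theorem tsum_interleave (h : IsBlockDecomposition q t β f c r b)
    (h' : IsBlockDecomposition q t β g c' r' b') :
    ∑' j, ‖interleave c c' j‖ = ∑' j, ‖c j‖ + ∑' j, ‖c' j‖ := by
  have h1 : HasSum (fun k => ‖interleave c c' (2 * k)‖) (∑' j, ‖c j‖) := by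
    simpa only [interleave_even] using h.summable.hasSum
  have h2 : HasSum (fun k => ‖interleave c c' (2 * k + 1)‖) (∑' j, ‖c' j‖) := by
    simpa only [interleave_odd] using h'.summable.hasSum
  exact (HasSum.even_add_odd (f := fun k => ‖interleave c c' k‖) h1 h2).tsum_eq

end IsBlockDecomposition

/-- The infimum of `∑ |c_j|` over all block decompositions of `f`. -/
noncomputable def blockNorm (q t : Fin n → ℝ≥0∞) (β : ℝ≥0∞) (f : (Fin n → ℝ) → ℂ) : ℝ :=
  sInf {a | ∃ c r b, IsBlockDecomposition q t β f c r b ∧ a = ∑' j, ‖c j‖}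

section block
variable (q t : Fin n → ℝ≥0∞) (β : ℝ≥0∞)

/-- The space `𝓗(q⃗, t⃗, β)` of (almost everywhere classes of) locally integrable functions that
admit a block decomposition, normed by `blockNorm`. -/
noncomputable def BlockSpace : Submodule ℂ ((Fin n → ℝ) →ₘ[volume] ℂ) where
  carrier := {u | LocallyIntegrable (⇑u) ∧ ∃ c r b, IsBlockDecomposition q t β u c r b}
  zero_mem' := by
    refine ⟨locallyIntegrable_zero.congr AEEqFun.coeFn_zero.symm, 0, fun _ => 1, 0, ?_⟩
    exact IsBlockDecomposition.zero.congr_ae AEEqFun.coeFn_zero.symm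
  add_mem' := by
    rintro u v ⟨hu, c, r, b, h⟩ ⟨hv, c', r', b', h'⟩
    exact ⟨(hu.add hv).congr (AEEqFun.coeFn_add u v).symm, _, _, _,
      (h.add h' u.measurable).congr_ae (AEEqFun.coeFn_add u v).symm⟩
  smul_mem' := by
    rintro a u ⟨hu, c, r, b, h⟩
    exact ⟨(hu.smul a).congr (AEEqFun.coeFn_smul a u).symm, _, _, _,
      (h.smul a).congr_ae (AEEqFun.coeFn_smul a u).symm⟩

noncomputable instance : Norm (BlockSpace q t β) where
  norm u := blockNorm q t β u

variable {q t β}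

theorem blockNorm_nonneg (f : (Fin n → ℝ) → ℂ) : 0 ≤ blockNorm q t β f :=
  Real.sInf_nonneg (by rintro a ⟨c, r, b, -, rfl⟩; exact tsum_nonneg fun _ => norm_nonneg _)

theorem blockNorm_le {f : (Fin n → ℝ) → ℂ} {c : ℕ → ℂ} {r : ℕ → ℝ} {b : ℕ → (Fin n → ℝ) → ℂ}
    (h : IsBlockDecomposition q t β f c r b) : blockNorm q t β f ≤ ∑' j, ‖c j‖ :=
  csInf_le ⟨0, by rintro a ⟨c, r, b, -, rfl⟩; exact tsum_nonneg fun _ => norm_nonneg _⟩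
    ⟨c, r, b, h, rfl⟩

theorem exists_lt_of_blockNorm_lt {f : (Fin n → ℝ) → ℂ}
    (hf : ∃ c r b, IsBlockDecomposition q t β f c r b) {ε : ℝ} (h : blockNorm q t β f < ε) :
    ∃ c r b, IsBlockDecomposition q t β f c r b ∧ ∑' j, ‖c j‖ < ε := by
  obtain ⟨c₀, r₀, b₀, hf⟩ := hf
  have hne : {a | ∃ c r b, IsBlockDecomposition q t β f c r b ∧ a = ∑' j, ‖c j‖}.Nonempty :=
    ⟨_, c₀, r₀, b₀, hf, rfl⟩
  obtain ⟨a, ⟨c, r, b, hd, rfl⟩, ha⟩ := exists_lt_of_csInf_lt hne h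
  exact ⟨c, r, b, hd, ha⟩

theorem blockNorm_smul_le (u : BlockSpace q t β) (a : ℂ) : ‖a • u‖ ≤ ‖a‖ * ‖u‖ := by
  refine le_of_forall_gt fun ε hε => ?_
  have key : ∃ δ, ‖u‖ < δ ∧ ‖a‖ * δ < ε := by
    have hc : Tendsto (fun δ => ‖a‖ * δ) (𝓝[>] ‖u‖) (𝓝 (‖a‖ * ‖u‖)) :=
      ((continuous_const.mul continuous_id).tendsto _).mono_left nhdsWithin_le_nhds
    exact ((eventually_mem_nhdsWithin).and (hc.eventually (gt_mem_nhds hε))).exists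
  obtain ⟨δ, hδ, hδε⟩ := key
  obtain ⟨c, r, b, hd, hlt⟩ := exists_lt_of_blockNorm_lt u.2.2 hδ
  refine lt_of_le_of_lt (blockNorm_le ((hd.smul a).congr_ae (AEEqFun.coeFn_smul a u.1).symm)) ?_
  simp only [norm_mul, tsum_mul_left]
  exact (mul_le_mul_of_nonneg_left hlt.le (norm_nonneg a)).trans_lt hδε

variable (q t β)

theorem blockSpace_core : SeminormedSpace.Core ℂ (BlockSpace q t β) where
  norm_nonneg u := blockNorm_nonneg _
  norm_smul a u := by
    refine le_antisymm (blockNorm_smul_le u a) ?_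
    rcases eq_or_ne a 0 with rfl | ha
    · rw [norm_zero, zero_mul]
      exact blockNorm_nonneg _
    · have h := blockNorm_smul_le (a • u) a⁻¹
      rw [smul_smul, inv_mul_cancel₀ ha, one_smul, norm_inv] at h
      exact (le_inv_mul_iff₀ (norm_pos_iff.2 ha)).1 h
  norm_triangle u v := by
    refine le_of_forall_pos_lt_add fun ε hε => ?_
    obtain ⟨c, r, b, hd, hlt⟩ := exists_lt_of_blockNorm_lt u.2.2
      (show blockNorm q t β u < ‖u‖ + ε / 2 from lt_add_of_pos_right _ (half_pos hε))
    obtain ⟨c', r', b', hd', hlt'⟩ := exists_lt_of_blockNorm_lt v.2.2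
      (show blockNorm q t β v < ‖v‖ + ε / 2 from lt_add_of_pos_right _ (half_pos hε))
    have h := blockNorm_le ((hd.add hd' u.1.measurable).congr_ae (AEEqFun.coeFn_add u.1 v.1).symm)
    rw [hd.tsum_interleave hd'] at h
    change blockNorm q t β _ < _
    refine lt_of_le_of_lt h ?_
    linarith

noncomputable instance : SeminormedAddCommGroup (BlockSpace q t β) :=
  SeminormedAddCommGroup.ofCore (blockSpace_core q t β)

noncomputable instance : NormedSpace ℂ (BlockSpace q t β) where
  norm_smul_le a u := blockNorm_smul_le u a

end block

end MixedAmalgam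

namespace MixedAmalgam

open scoped NNReal

/-! Write q, t, β for the exponents conjugate to p, s, α. Substituting x = r y turns the pairing of
a dilated block `dilate β r b` with g into r^(n/α) ∫ b(y) g(r y) dy. Hölder's inequality for mixed
norms, on each unit cube and then across the cubes, bounds this by the (q, t) norm of b times
r^(n/α) times the (p, s) norm of g(r ·). The last two factors together are the term of index r in
the supremum defining the norm of g. So each block pairs with g at a cost of at most ‖g‖, and
summing a block decomposition gives part (i) (`integrable_mul_and_norm_integral_le`).

For the isometry, Hölder's inequality is sharp. For every r there are b in the unit ball of the (q,
t) amalgam whose pairings with g(r ·) come arbitrarily close to its (p, s) norm, and their dilates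
have norm at most 1 in the block space (`fofanaENorm_le_of_forall_pairing_le`, `norm_pairing`).

For surjectivity, q and t are finite because p, s > 1, so dominated convergence holds in the amalgam
norm, and hence in the block space for the dilates at a fixed scale. Fix a positive weight w of
finite (q, t) norm. For a continuous functional L, the set function E ↦ L(w χ_E) is then a complex
measure that vanishes on null sets, hence has an integrable density h. Put g = h / w. Then L f = ∫ f
g whenever |f| ≤ C w (`exists_density`). The almost norming blocks can be chosen with dilates
bounded by multiples of w, so the estimate behind the isometry gives ‖g‖ ≤ ‖L‖. Finally L and the
pairing with g agree on functions bounded by multiples of w; truncation and the convergence of block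
decompositions in norm carry this to the whole block space (`dual_ext`). -/

theorem conjugate_cases {p q : ℝ≥0∞} (h : p⁻¹ + q⁻¹ = 1) :
    (p = 1 ∧ q = ∞) ∨ (p = ∞ ∧ q = 1) ∨
      (p ≠ 0 ∧ p ≠ ∞ ∧ q ≠ 0 ∧ q ≠ ∞ ∧ p.toReal.HolderConjugate q.toReal) := by
  have : ENNReal.HolderConjugate p q := ENNReal.holderConjugate_iff.2 h
  by_cases hp : p = ∞
  · exact Or.inr (Or.inl ⟨hp, (ENNReal.HolderConjugate.eq_top_iff_eq_one p q).1 hp⟩)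
  by_cases hq : q = ∞
  · exact Or.inl ⟨(ENNReal.HolderConjugate.eq_top_iff_eq_one q p).1 hq, hq⟩
  have hp0 := ENNReal.HolderConjugate.ne_zero p q
  have hq0 := ENNReal.HolderConjugate.ne_zero q p
  refine Or.inr (Or.inr ⟨hp0, hp, hq0, hq, ?_⟩)
  have := ENNReal.HolderTriple.toReal 1 (p := p) (q := q) (ENNReal.toReal_pos hp0 hp)
    (ENNReal.toReal_pos hq0 hq)
  simpa using this

theorem one_le_of_conjugate {p q : ℝ≥0∞} (h : p⁻¹ + q⁻¹ = 1) : 1 ≤ q := by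
  have : ENNReal.HolderConjugate p q := ENNReal.holderConjugate_iff.2 h
  exact ENNReal.HolderConjugate.one_le q p

/-! ### Mixed norms: Hölder, dominated convergence, converse Hölder. -/

section mixed
variable {X : Type} [MeasurableSpace X] {μ : Measure X}

theorem eLpNorm_ennreal {q : ℝ≥0∞} (h0 : q ≠ 0) (ht : q ≠ ∞) (f : X → ℝ≥0∞) :
    eLpNorm f q μ = (∫⁻ t, f t ^ q.toReal ∂μ) ^ (1 / q.toReal) := by
  simp [eLpNorm_eq_lintegral_rpow_enorm_toReal h0 ht]

theorem eLpNorm_top_ennreal (f : X → ℝ≥0∞) : eLpNorm f ∞ μ = essSup f μ := by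
  simp [eLpNormEssSup_eq_essSup_enorm]

theorem eLpNorm_one_ennreal (f : X → ℝ≥0∞) : eLpNorm f 1 μ = ∫⁻ t, f t ∂μ := by
  simp [eLpNorm_one_eq_lintegral_enorm]

theorem lintegral_mul_le_essSup_mul {f g : X → ℝ≥0∞} (hg : AEMeasurable g μ) :
    ∫⁻ t, f t * g t ∂μ ≤ essSup f μ * ∫⁻ t, g t ∂μ := by
  rw [← lintegral_const_mul'' _ hg]
  refine lintegral_mono_ae ?_
  filter_upwards [ENNReal.ae_le_essSup f] with t ht
  gcongr

theorem lintegral_mul_le_eLpNorm_mul {p q : ℝ≥0∞} (h : p⁻¹ + q⁻¹ = 1) {f g : X → ℝ≥0∞}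
    (hf : AEMeasurable f μ) (hg : AEMeasurable g μ) :
    ∫⁻ t, f t * g t ∂μ ≤ eLpNorm f p μ * eLpNorm g q μ := by
  rcases conjugate_cases h with ⟨rfl, rfl⟩ | ⟨rfl, rfl⟩ | ⟨hp0, hp, hq0, hq, hpq⟩
  · rw [eLpNorm_one_ennreal, eLpNorm_top_ennreal, mul_comm]
    simp only [mul_comm (f _)]
    exact lintegral_mul_le_essSup_mul hf
  · rw [eLpNorm_one_ennreal, eLpNorm_top_ennreal]
    exact lintegral_mul_le_essSup_mul hg
  · rw [eLpNorm_ennreal hp0 hp, eLpNorm_ennreal hq0 hq]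
    exact ENNReal.lintegral_mul_le_Lp_mul_Lq μ hpq hf hg

theorem measurable_cons_left {n : ℕ} (y : Fin n → X) :
    Measurable fun t : X => (Fin.cons t y : Fin (n + 1) → X) :=
  measurable_cons.comp (measurable_const.prodMk measurable_id)

theorem lintegral_pi_succ [SigmaFinite μ] {n : ℕ} {F : (Fin (n + 1) → X) → ℝ≥0∞}
    (hF : Measurable F) :
    ∫⁻ x, F x ∂(Measure.pi fun _ => μ)
      = ∫⁻ y, ∫⁻ t, F (Fin.cons t y) ∂μ ∂(Measure.pi fun _ : Fin n => μ) := by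
  have h1 := ((measurePreserving_piFinSuccAbove (fun _ : Fin (n + 1) => μ) 0).symm).lintegral_comp hF
  rw [← h1]
  refine (lintegral_prod_symm' _ (hF.comp (MeasurableEquiv.measurable _))).trans ?_
  simp [MeasurableEquiv.piFinSuccAbove_symm_apply, Fin.insertNthEquiv]

theorem lintegral_pi_zero (F : (Fin 0 → X) → ℝ≥0∞) :
    ∫⁻ x, F x ∂(Measure.pi fun _ => μ) = F Fin.elim0 := by
  rw [Measure.pi_of_empty _ Fin.elim0, lintegral_dirac]

/-- By Tonelli, Hölder in the innermost variable leaves a product of two slice norms, to which the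
induction hypothesis applies. -/
theorem lintegral_mul_le_mixedENorm [SigmaFinite μ] {n : ℕ} {p q : Fin n → ℝ≥0∞}
    (h : ∀ i, (p i)⁻¹ + (q i)⁻¹ = 1) {F G : (Fin n → X) → ℝ≥0∞}
    (hF : Measurable F) (hG : Measurable G) :
    ∫⁻ x, F x * G x ∂(Measure.pi fun _ => μ) ≤ mixedENorm μ p F * mixedENorm μ q G := by
  induction n with
  | zero => rw [lintegral_pi_zero]; rfl
  | succ n ih =>
    refine (lintegral_pi_succ (hF.mul hG)).trans_le ?_
    refine le_trans (lintegral_mono fun y => ?_)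
      (ih (fun i => h i.succ) (measurable_inner hF (p 0)) (measurable_inner hG (q 0)))
    exact lintegral_mul_le_eLpNorm_mul (h 0) (hF.comp (measurable_cons_left y)).aemeasurable
      (hG.comp (measurable_cons_left y)).aemeasurable

theorem ae_of_ae_slice [SigmaFinite μ] {n : ℕ} {P : (Fin (n + 1) → X) → Prop}
    (hP : MeasurableSet {x | P x})
    (h : ∀ᵐ y ∂(Measure.pi fun _ : Fin n => μ), ∀ᵐ t ∂μ, P (Fin.cons t y)) :
    ∀ᵐ x ∂(Measure.pi fun _ : Fin (n + 1) => μ), P x := by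
  have hs : MeasurableSet {z : (Fin n → X) × X | P (Fin.cons z.2 z.1)} := measurable_cons hP
  have h2 : ∀ᵐ z ∂((Measure.pi fun _ : Fin n => μ).prod μ), P (Fin.cons z.2 z.1) := by
    rwa [Measure.ae_prod_iff_ae_ae hs]
  have h3 := (Measure.measurePreserving_swap (μ := μ)
    (ν := Measure.pi fun _ : Fin n => μ)).quasiMeasurePreserving.ae h2
  have h4 := (measurePreserving_piFinSuccAbove
    (fun _ : Fin (n + 1) => μ) 0).quasiMeasurePreserving.ae h3
  filter_upwards [h4] with x hx
  simpa [MeasurableEquiv.piFinSuccAbove, Fin.insertNthEquiv, Fin.removeNth,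
    Fin.cons_self_tail] using hx

theorem ae_lt_top_of_eLpNorm_ne_top {q : ℝ≥0∞} (hq : 1 ≤ q) {f : X → ℝ≥0∞} (hf : Measurable f)
    (h : eLpNorm f q μ ≠ ∞) : ∀ᵐ t ∂μ, f t < ∞ := by
  have h0 : q ≠ 0 := (zero_lt_one.trans_le hq).ne'
  by_cases ht : q = ∞
  · subst ht
    rw [eLpNorm_top_ennreal] at h
    filter_upwards [ENNReal.ae_le_essSup f] with t ht
    exact ht.trans_lt (lt_top_iff_ne_top.2 h)
  · have hq' := ENNReal.toReal_pos h0 ht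
    rw [eLpNorm_ennreal h0 ht] at h
    have h1 : ∫⁻ t, f t ^ q.toReal ∂μ ≠ ∞ := fun h2 => h (by
      rw [h2, ENNReal.top_rpow_of_pos (by positivity)])
    filter_upwards [ae_lt_top (hf.pow_const _) h1] with t ht
    exact (ENNReal.rpow_lt_top_iff_of_pos hq').1 ht

theorem ae_lt_top_of_mixedENorm_ne_top [SigmaFinite μ] {n : ℕ} {q : Fin n → ℝ≥0∞}
    (hq : ∀ i, 1 ≤ q i) {F : (Fin n → X) → ℝ≥0∞} (hF : Measurable F)
    (h : mixedENorm μ q F ≠ ∞) : ∀ᵐ x ∂(Measure.pi fun _ => μ), F x < ∞ := by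
  induction n with
  | zero =>
    refine Eventually.of_forall fun x => ?_
    rw [Subsingleton.elim x Fin.elim0]
    exact lt_top_iff_ne_top.2 h
  | succ n ih =>
    refine ae_of_ae_slice (hF measurableSet_Iio) ?_
    filter_upwards [ih (fun i => hq i.succ) (measurable_inner hF (q 0)) h] with y hy
    exact ae_lt_top_of_eLpNorm_ne_top (hq 0) (hF.comp (measurable_cons_left y)) hy.ne

/-- Dominated convergence for the q-th powers, which is where q must be finite. The filter is
general because countable additivity will be tested along finite subsets of ℕ. -/
theorem tendsto_eLpNorm_zero {q : ℝ≥0∞} (hq : 1 ≤ q) (ht : q ≠ ∞) {ι : Type} {l : Filter ι}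
    [l.IsCountablyGenerated] {f : ι → X → ℝ≥0∞} {g : X → ℝ≥0∞}
    (hf : ∀ m, Measurable (f m)) (hfg : ∀ m, ∀ᵐ t ∂μ, f m t ≤ g t)
    (hg' : eLpNorm g q μ ≠ ∞) (h : ∀ᵐ t ∂μ, Tendsto (fun m => f m t) l (𝓝 0)) :
    Tendsto (fun m => eLpNorm (f m) q μ) l (𝓝 0) := by
  have h0 : q ≠ 0 := (zero_lt_one.trans_le hq).ne'
  have hq' := ENNReal.toReal_pos h0 ht
  simp only [eLpNorm_ennreal h0 ht] at hg' ⊢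
  have h1 : ∫⁻ t, g t ^ q.toReal ∂μ ≠ ∞ := fun h2 => hg' (by
      rw [h2, ENNReal.top_rpow_of_pos (by positivity)])
  have h2 := tendsto_lintegral_filter_of_dominated_convergence (l := l) (μ := μ)
    (F := fun m t => f m t ^ q.toReal) (f := fun _ => 0) (fun t => g t ^ q.toReal)
    (Eventually.of_forall fun m => (hf m).pow_const _)
    (Eventually.of_forall fun m => (hfg m).mono fun t ht => ENNReal.rpow_le_rpow ht hq'.le) h1
    (h.mono fun t ht => by
      have := ht.ennrpow_const q.toReal
      rwa [ENNReal.zero_rpow_of_pos hq'] at this)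
  have h3 := h2.ennrpow_const (1 / q.toReal)
  rwa [lintegral_zero, ENNReal.zero_rpow_of_pos (by positivity)] at h3

/-- The slice norms of the F m are dominated by the slice norm of G, which is finite for almost
every slice. They therefore tend to zero almost everywhere, and the induction hypothesis applies to
them. -/
theorem tendsto_mixedENorm_zero [SigmaFinite μ] {n : ℕ} {q : Fin n → ℝ≥0∞}
    (hq : ∀ i, 1 ≤ q i) (ht : ∀ i, q i ≠ ∞) {ι : Type} {l : Filter ι}
    [l.IsCountablyGenerated] {F : ι → (Fin n → X) → ℝ≥0∞} {G : (Fin n → X) → ℝ≥0∞}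
    (hF : ∀ m, Measurable (F m)) (hG : Measurable G)
    (hFG : ∀ m, F m ≤ G) (hG' : mixedENorm μ q G ≠ ∞)
    (h : ∀ᵐ x ∂(Measure.pi fun _ => μ), Tendsto (fun m => F m x) l (𝓝 0)) :
    Tendsto (fun m => mixedENorm μ q (F m)) l (𝓝 0) := by
  induction n with
  | zero =>
    rw [Measure.pi_of_empty _ Fin.elim0] at h
    simp only [ae_dirac_eq] at h
    exact eventually_pure.1 h
  | succ n ih =>
    refine ih (fun i => hq i.succ) (fun i => ht i.succ) (fun m => measurable_inner (hF m) (q 0))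
      (measurable_inner hG (q 0))
      (fun m y => eLpNorm_mono_enorm fun t => by simpa using hFG m _) hG' ?_
    filter_upwards [ae_slice h, ae_lt_top_of_mixedENorm_ne_top (fun i => hq i.succ)
      (measurable_inner hG (q 0)) hG'] with y hy hy'
    exact tendsto_eLpNorm_zero (hq 0) (ht 0) (fun m => (hF m).comp (measurable_cons_left y))
      (fun m => Eventually.of_forall fun t => hFG m _) hy'.ne hy

theorem eLpNorm_iSup {q : ℝ≥0∞} (h0 : q ≠ 0) {f : ℕ → X → ℝ≥0∞} (hf : ∀ m, Measurable (f m))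
    (hm : Monotone f) :
    eLpNorm (fun t => ⨆ m, f m t) q μ = ⨆ m, eLpNorm (f m) q μ := by
  by_cases ht : q = ∞
  · subst ht
    simp only [eLpNorm_top_ennreal]
    refine le_antisymm ?_ (iSup_le fun m => essSup_mono_ae (Eventually.of_forall fun t =>
      le_iSup (fun m => f m t) m))
    refine essSup_le_of_ae_le _ ?_
    filter_upwards [ae_all_iff.2 fun m => ENNReal.ae_le_essSup (μ := μ) (f m)] with t ht
    exact iSup_mono ht
  · have hq' := ENNReal.toReal_pos h0 ht
    have hr : 0 < 1 / q.toReal := by positivity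
    simp only [eLpNorm_ennreal h0 ht]
    have e1 : ∀ t, (⨆ m, f m t) ^ q.toReal = ⨆ m, f m t ^ q.toReal := fun t =>
      (ENNReal.orderIsoRpow _ hq').map_iSup fun m => f m t
    simp only [e1]
    rw [lintegral_iSup (fun m => (hf m).pow_const _)
      (fun a b hab t => ENNReal.rpow_le_rpow (hm hab t) hq'.le)]
    exact (ENNReal.orderIsoRpow _ hr).map_iSup _

/-- An almost norming kernel: for every slice of a bounded function supported in a set of finite
measure, a function of norm at most one in the dual space nearly attaining the norm, measurably in
the slice. -/
theorem exists_norming_kernel [SFinite μ] {Y : Type} [MeasurableSpace Y] {p q : ℝ≥0∞}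
    (h : p⁻¹ + q⁻¹ = 1) {F : Y × X → ℝ≥0∞} (hF : Measurable F) {C : ℝ≥0∞} (hC : C ≠ ∞)
    (hFC : ∀ z, F z ≤ C) {S : Set X} (hS : μ S ≠ ∞) (hFS : ∀ y, ∀ t ∉ S, F (y, t) = 0)
    {θ : ℝ≥0∞} (hθ : θ < 1) :
    ∃ K : Y × X → ℝ≥0∞, Measurable K ∧ (∀ y, eLpNorm (fun t => K (y, t)) q μ ≤ 1) ∧
      ∀ y, θ * eLpNorm (fun t => F (y, t)) p μ ≤ ∫⁻ t, F (y, t) * K (y, t) ∂μ := by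
  rcases conjugate_cases h with ⟨rfl, rfl⟩ | ⟨rfl, rfl⟩ | ⟨hp0, hp, hq0, hq, hpq⟩
  · refine ⟨fun _ => 1, measurable_const, fun y => ?_, fun y => ?_⟩
    · rw [eLpNorm_top_ennreal]
      exact essSup_le_of_ae_le _ (Eventually.of_forall fun _ => le_rfl)
    · simp only [mul_one]
      rw [eLpNorm_one_ennreal]
      exact mul_le_of_le_one_left zero_le hθ.le
  · have hN := measurable_eLpNorm_slice (μ := μ) hF ∞
    set N : Y → ℝ≥0∞ := fun y => eLpNorm (fun t => F (y, t)) ∞ μ with hNdef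
    -- For p = ∞ the kernel is the normalized indicator of the part of the slice where F exceeds θ
    -- times its essential supremum; averaging F over it gives at least θ N.
    set A : Set (Y × X) := {z | θ * N z.1 < F z} with hA
    have hAm : MeasurableSet A :=
      measurableSet_lt ((hN.comp measurable_fst).const_mul θ) hF
    have ha := measurable_measure_prodMk_left (ν := μ) hAm
    have hAy : ∀ y, MeasurableSet (Prod.mk y ⁻¹' A) := fun y => measurable_prodMk_left hAm
    have hK : ∀ y t, A.indicator (fun z => (μ (Prod.mk z.1 ⁻¹' A))⁻¹) (y, t)
        = (Prod.mk y ⁻¹' A).indicator (fun _ => (μ (Prod.mk y ⁻¹' A))⁻¹) t := fun y t => by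
      simp [Set.indicator]
    refine ⟨A.indicator fun z => (μ (Prod.mk z.1 ⁻¹' A))⁻¹,
      (ha.inv.comp measurable_fst).indicator hAm, fun y => ?_, fun y => ?_⟩
    · rw [eLpNorm_one_ennreal]
      simp only [hK]
      rw [lintegral_indicator_const (hAy y)]
      exact ENNReal.inv_mul_le_one _
    · have hfin : μ (Prod.mk y ⁻¹' A) ≠ ∞ := by
        refine measure_ne_top_of_subset (fun t ht => ?_) hS
        by_contra hts
        have : θ * N y < F (y, t) := ht
        rw [hFS y t hts] at this
        exact not_lt_zero this
      have hNfin : N y ≠ ∞ := by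
        refine ne_top_of_le_ne_top hC ?_
        simp only [hNdef, eLpNorm_top_ennreal]
        exact essSup_le_of_ae_le _ (Eventually.of_forall fun t => hFC _)
      -- On a null slice of A the kernel is useless, but then N y ≤ θ N y, and finiteness of N y
      -- forces N y = 0.
      by_cases h0 : μ (Prod.mk y ⁻¹' A) = 0
      · have h1 : N y ≤ θ * N y := by
          conv_lhs => rw [hNdef]
          simp only [eLpNorm_top_ennreal]
          refine essSup_le_of_ae_le _ ?_
          rw [Filter.EventuallyLE, ae_iff]
          simpa [hA] using h0
        have h2 : N y = 0 := by
          by_contra hne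
          have := (ENNReal.mul_lt_mul_iff_left hne hNfin).2 hθ
          rw [one_mul] at this
          exact (this.trans_le h1).false
        change θ * N y ≤ _
        simp [h2]
      · calc θ * N y = ∫⁻ t, (Prod.mk y ⁻¹' A).indicator
              (fun _ => θ * N y * (μ (Prod.mk y ⁻¹' A))⁻¹) t ∂μ := by
              rw [lintegral_indicator_const (hAy y), mul_assoc,
                ENNReal.inv_mul_cancel h0 hfin, mul_one]
          _ ≤ _ := by
              refine lintegral_mono fun t => ?_
              rw [hK]
              by_cases ht : t ∈ Prod.mk y ⁻¹' A
              · simp only [Set.indicator_of_mem ht]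
                gcongr
                exact (show θ * N y < F (y, t) from ht).le
              · simp [Set.indicator_of_notMem ht]
  · have hP := hpq.pos
    have hQ := hpq.symm.pos
    set P := p.toReal
    set Q := q.toReal
    have hI : Measurable fun y => ∫⁻ t, F (y, t) ^ P ∂μ :=
      Measurable.lintegral_prod_right' (hF.pow_const _)
    set I : Y → ℝ≥0∞ := fun y => ∫⁻ t, F (y, t) ^ P ∂μ with hIdef
    have hIfin : ∀ y, I y ≠ ∞ := fun y => by
      have h1 : I y ≤ ∫⁻ t in S, C ^ P ∂μ := by
        refine le_trans (lintegral_mono fun t => ?_) (lintegral_indicator_le (fun _ => C ^ P) S)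
        by_cases ht : t ∈ S
        · rw [Set.indicator_of_mem ht]
          exact ENNReal.rpow_le_rpow (hFC _) hP.le
        · rw [hFS y t ht, ENNReal.zero_rpow_of_pos hP]
          exact zero_le
      refine ne_top_of_le_ne_top ?_ h1
      rw [lintegral_const, Measure.restrict_apply_univ]
      exact ENNReal.mul_ne_top (ENNReal.rpow_ne_top_of_nonneg hP.le hC) hS
    -- The equality case of Hölder's inequality, using (P - 1) Q = P. If I y = 0 the second factor
    -- is ∞, which is harmless: the Q-th power integrates to (I y)⁻¹ * I y ≤ 1.
    refine ⟨fun z => F z ^ (P - 1) * I z.1 ^ (-Q⁻¹),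
      (hF.pow_const _).mul ((hI.comp measurable_fst).pow_const _), fun y => ?_, fun y => ?_⟩
    · rw [eLpNorm_ennreal hq0 hq]
      have e : ∀ t, (F (y, t) ^ (P - 1) * I y ^ (-Q⁻¹)) ^ Q = (I y)⁻¹ * F (y, t) ^ P := fun t => by
        rw [ENNReal.mul_rpow_of_nonneg _ _ hQ.le, ← ENNReal.rpow_mul, ← ENNReal.rpow_mul,
          hpq.sub_one_mul_conj, neg_mul, inv_mul_cancel₀ hQ.ne', ENNReal.rpow_neg_one, mul_comm]
      refine ENNReal.rpow_le_one ?_ (by positivity)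
      simp only [show q.toReal = Q from rfl, e]
      rw [lintegral_const_mul _ (f := fun t => F (y, t) ^ P)
        ((hF.comp measurable_prodMk_left).pow_const _)]
      exact ENNReal.inv_mul_le_one _
    · rw [eLpNorm_ennreal hp0 hp]
      change θ * I y ^ (1 / P) ≤ _
      refine (mul_le_of_le_one_left zero_le hθ.le).trans ?_
      by_cases h0 : I y = 0
      · rw [h0, ENNReal.zero_rpow_of_pos (by positivity)]
        exact zero_le
      have e : ∀ t, F (y, t) * (F (y, t) ^ (P - 1) * I y ^ (-Q⁻¹))
          = I y ^ (-Q⁻¹) * F (y, t) ^ P := fun t => by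
        have : F (y, t) ^ P = F (y, t) * F (y, t) ^ (P - 1) := by
          conv_lhs => rw [show P = 1 + (P - 1) by ring]
          rw [ENNReal.rpow_add_of_nonneg _ _ zero_le_one hpq.sub_one_pos.le, ENNReal.rpow_one]
        rw [this]; ring
      simp only [e]
      rw [lintegral_const_mul _ (f := fun t => F (y, t) ^ P)
        ((hF.comp measurable_prodMk_left).pow_const _)]
      change _ ≤ I y ^ (-Q⁻¹) * I y
      nth_rewrite 3 [← ENNReal.rpow_one (I y)]
      rw [← ENNReal.rpow_add _ _ h0 (hIfin y)]
      refine le_of_eq ?_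
      congr 1
      have := hpq.inv_add_inv_eq_one
      rw [one_div]
      linarith

theorem exists_lt_one_lt_mul {c I : ℝ≥0∞} (h : c < I) : ∃ θ < 1, c < θ * I := by
  by_cases hI : I = ∞
  · refine ⟨2⁻¹, by norm_num, ?_⟩
    rw [hI, ENNReal.mul_top (by simp)]
    exact h.trans_le le_top
  · obtain ⟨d, hcd, hdI⟩ := exists_between h
    have h0 : I ≠ 0 := (zero_le.trans_lt h).ne'
    refine ⟨d / I, ENNReal.div_lt_of_lt_mul (by simpa using hdI), ?_⟩
    rwa [ENNReal.div_mul_cancel h0 hI]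

/-- Converse Hölder. The induction hypothesis gives an H that almost norms the function of slice
norms, and a measurable kernel K almost norms each slice; the product H K works. The strict
inequality c < ‖F‖ leaves room for the losses and also covers an infinite norm. -/
theorem exists_mixedENorm_le_one_lt_lintegral [SigmaFinite μ] {n : ℕ} {p q : Fin n → ℝ≥0∞}
    (h : ∀ i, (p i)⁻¹ + (q i)⁻¹ = 1) {F : (Fin n → X) → ℝ≥0∞} (hF : Measurable F) {c : ℝ≥0∞}
    (hc : c < mixedENorm μ p F) :
    ∃ G : (Fin n → X) → ℝ≥0∞, Measurable G ∧ mixedENorm μ q G ≤ 1 ∧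
      c < ∫⁻ x, F x * G x ∂(Measure.pi fun _ => μ) := by
  induction n generalizing c with
  | zero =>
    refine ⟨fun _ => 1, measurable_const, le_rfl, ?_⟩
    rw [lintegral_pi_zero, mul_one]
    exact hc
  | succ n ih =>
    obtain ⟨H, hH, hH1, hcH⟩ := ih (fun i => h i.succ) (measurable_inner hF (p 0)) hc
    have hp0 : p 0 ≠ 0 := (zero_lt_one.trans_le
      (one_le_of_conjugate ((add_comm _ _).trans (h 0)))).ne'
    -- `exists_norming_kernel` needs a bounded function supported in a set of finite measure, so F
    -- is cut at height m and restricted to the m-th spanning set. By monotone convergence a single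
    -- m serves for all slices at once.
    set E : ℕ → (Fin n → X) × X → ℝ≥0∞ := fun m z =>
      (spanningSets μ m).indicator (fun _ => min (F (Fin.cons z.2 z.1)) m) z.2 with hE
    have hEm : ∀ m, Measurable (E m) := fun m => by
      have : E m = (Prod.snd ⁻¹' spanningSets μ m).indicator
          (fun z : (Fin n → X) × X => min (F (Fin.cons z.2 z.1)) m) := by
        ext z; simp [hE, Set.indicator, Set.mem_preimage]; rfl
      rw [this]
      exact ((hF.comp measurable_cons).min measurable_const).indicator
        (measurable_snd (measurableSet_spanningSets μ m))
    have hEmono : Monotone E := fun a b hab z => by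
      refine (Set.indicator_le_indicator_of_subset (monotone_spanningSets μ hab)
        (fun _ => zero_le) _).trans (Set.indicator_le_indicator ?_)
      exact min_le_min_left _ (by exact_mod_cast hab)
    have hEsup : ∀ z, ⨆ m, E m z = F (Fin.cons z.2 z.1) := fun z => by
      refine le_antisymm (iSup_le fun m => ?_) (le_of_forall_lt fun d hd => ?_)
      · exact (Set.indicator_le_self _ _ _).trans (min_le_left _ _)
      · obtain ⟨N, hN⟩ := ENNReal.exists_nat_gt (hd.trans_le le_top).ne
        obtain ⟨k, hk⟩ := Set.mem_iUnion.1 ((iUnion_spanningSets μ).symm ▸ Set.mem_univ z.2)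
        refine lt_of_lt_of_le ?_ (le_iSup (fun m => E m z) (max N k))
        rw [hE]
        simp only
        rw [Set.indicator_of_mem (monotone_spanningSets μ (le_max_right N k) hk)]
        exact lt_min hd (hN.trans_le (by exact_mod_cast le_max_left N k))
    have hN : ∀ y, eLpNorm (fun t => F (Fin.cons t y)) (p 0) μ
        = ⨆ m, eLpNorm (fun t => E m (y, t)) (p 0) μ := fun y => by
      rw [← eLpNorm_iSup (f := fun m t => E m (y, t)) hp0
        (fun m => (hEm m).comp measurable_prodMk_left) (fun a b hab t => hEmono hab _)]
      simp only [hEsup]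
    simp only [hN, ENNReal.iSup_mul] at hcH
    rw [lintegral_iSup (f := fun m y => eLpNorm (fun t => E m (y, t)) (p 0) μ * H y)
      (fun m => (measurable_eLpNorm_slice (hEm m) _).mul hH)
      (fun a b hab y => mul_le_mul_left (eLpNorm_mono_enorm fun t => by
        simpa using hEmono hab (y, t)) _)] at hcH
    obtain ⟨m, hm⟩ := lt_iSup_iff.1 hcH
    obtain ⟨θ, hθ, hcθ⟩ := exists_lt_one_lt_mul hm
    obtain ⟨K, hK, hK1, hKθ⟩ := exists_norming_kernel (μ := μ) (h 0) (hEm m)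
      (C := m) (ENNReal.natCast_ne_top m)
      (fun z => (Set.indicator_le_self _ _ _).trans (min_le_right _ _))
      (S := spanningSets μ m) (measure_spanningSets_lt_top μ m).ne
      (fun y t ht => Set.indicator_of_notMem ht _) hθ
    have htail : Measurable fun x : Fin (n + 1) → X => (Fin.tail x, x 0) :=
      (measurable_pi_lambda _ fun i => measurable_pi_apply i.succ).prodMk (measurable_pi_apply 0)
    have hGm : Measurable fun x : Fin (n + 1) → X => H (Fin.tail x) * K (Fin.tail x, x 0) :=
      (hH.comp (measurable_fst.comp htail)).mul (hK.comp htail)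
    refine ⟨_, hGm, ?_, ?_⟩
    · refine le_trans (mixedENorm_mono (fun i => q i.succ) fun y => ?_) hH1
      simp only [Fin.tail_cons, Fin.cons_zero]
      by_cases hy : H y = ∞
      · rw [hy]; exact le_top
      · rw [eLpNorm_const_mul_ennreal hy]
        exact mul_le_of_le_one_right zero_le (hK1 y)
    · refine lt_of_lt_of_eq ?_ (lintegral_pi_succ (hF.mul hGm)).symm
      refine hcθ.trans_le ?_
      rw [← lintegral_const_mul' _ _ (hθ.trans ENNReal.one_lt_top).ne]
      refine lintegral_mono fun y => ?_
      simp only [Pi.mul_apply, Fin.tail_cons, Fin.cons_zero]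
      calc θ * (eLpNorm (fun t => E m (y, t)) (p 0) μ * H y)
          ≤ (∫⁻ t, E m (y, t) * K (y, t) ∂μ) * H y := by
            rw [← mul_assoc]; gcongr; exact hKθ y
        _ = ∫⁻ t, E m (y, t) * K (y, t) * H y ∂μ := by
            rw [lintegral_mul_const]
            exact ((hEm m).comp measurable_prodMk_left).mul (hK.comp measurable_prodMk_left)
        _ ≤ _ := lintegral_mono fun t => by
            rw [mul_assoc, mul_comm (K _)]
            gcongr
            rw [← hEsup (y, t)]
            exact le_iSup (fun m => E m (y, t)) m

/-- In each step the other factors are constants for the innermost norm. The finiteness assumptions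
are what `eLpNorm_const_mul_ennreal` and `mixedENorm_const_mul` need to pull them out. -/
theorem mixedENorm_prod {n : ℕ} (q : Fin n → ℝ≥0∞) (f : Fin n → X → ℝ≥0∞)
    (hf : ∀ i t, f i t ≠ ∞) (hN : ∀ i, eLpNorm (f i) (q i) μ ≠ ∞) :
    mixedENorm μ q (fun x => ∏ i, f i (x i)) = ∏ i, eLpNorm (f i) (q i) μ := by
  induction n with
  | zero => simp [mixedENorm]
  | succ n ih =>
    have e : ∀ y : Fin n → X, eLpNorm (fun t => ∏ i, f i ((Fin.cons t y : Fin (n + 1) → X) i))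
        (q 0) μ = eLpNorm (f 0) (q 0) μ * ∏ i : Fin n, f i.succ (y i) := fun y => by
      simp only [Fin.prod_univ_succ, Fin.cons_zero, Fin.cons_succ]
      simp only [mul_comm (f 0 _)]
      rw [eLpNorm_const_mul_ennreal (ENNReal.prod_ne_top fun i _ => hf _ _), mul_comm]
    simp only [mixedENorm, e]
    rw [mixedENorm_const_mul _ (hN 0), ih (fun i => q i.succ) (fun i => f i.succ)
      (fun i => hf i.succ) (fun i => hN i.succ), Fin.prod_univ_succ]

end mixed

/-! ### The same three facts for the amalgam norm over unit cubes. -/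

variable {n : ℕ}

theorem mem_cube_one_iff {x : Fin n → ℝ} {k : Fin n → ℤ} :
    x ∈ cube 1 k ↔ k = fun i => ⌊x i⌋ := by
  simp only [cube, one_mul, Set.mem_ofPred_eq, funext_iff]
  exact forall_congr' fun i => by rw [← Int.floor_eq_iff, eq_comm]

theorem tsum_indicator_cube (F : (Fin n → ℤ) → (Fin n → ℝ) → ℝ≥0∞) {x : Fin n → ℝ}
    {k : Fin n → ℤ} (hx : x ∈ cube 1 k) : ∑' l, (cube 1 l).indicator (F l) x = F k x := by
  rw [tsum_eq_single k, Set.indicator_of_mem hx]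
  intro l hl
  refine Set.indicator_of_notMem (fun h => hl ?_) _
  rw [mem_cube_one_iff.1 h, mem_cube_one_iff.1 hx]

theorem lintegral_eq_tsum_cube {F : (Fin n → ℝ) → ℝ≥0∞} (hF : Measurable F) :
    ∫⁻ x, F x = ∑' k, ∫⁻ x, (cube 1 k).indicator F x := by
  rw [← lintegral_tsum fun k => (hF.indicator (measurableSet_cube 1 k)).aemeasurable]
  refine lintegral_congr fun x => ?_
  rw [tsum_indicator_cube (fun _ => F) (mem_cube_one_iff.2 rfl)]

theorem lintegral_pi_count (a : (Fin n → ℤ) → ℝ≥0∞) :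
    ∫⁻ k, a k ∂(Measure.pi fun _ : Fin n => (Measure.count : Measure ℤ)) = ∑' k, a k := by
  rw [lintegral_countable']
  simp [Measure.pi_singleton]

/-- The norm of the amalgam space `(L^{p⃗}, ℓ^{s⃗})` on nonnegative functions. -/
noncomputable def amalgamENorm (p s : Fin n → ℝ≥0∞) (F : (Fin n → ℝ) → ℝ≥0∞) : ℝ≥0∞ :=
  mixedENorm Measure.count s fun k : Fin n → ℤ => mixedENorm volume p ((cube 1 k).indicator F)

theorem scaledENorm_one_eq (p s : Fin n → ℝ≥0∞) (f : (Fin n → ℝ) → ℂ) :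
    scaledENorm 1 p s f = amalgamENorm p s fun x => ‖f x‖ₑ := by
  simp only [scaledENorm, amalgamENorm, enorm_indicator_eq_indicator_enorm]

theorem amalgamENorm_mono (p s : Fin n → ℝ≥0∞) {F G : (Fin n → ℝ) → ℝ≥0∞} (h : F ≤ G) :
    amalgamENorm p s F ≤ amalgamENorm p s G :=
  mixedENorm_mono s fun _ => mixedENorm_mono p fun x => Set.indicator_le_indicator (h x)

theorem lintegral_mul_le_amalgamENorm {p s q t : Fin n → ℝ≥0∞}
    (hpq : ∀ i, (p i)⁻¹ + (q i)⁻¹ = 1) (hst : ∀ i, (s i)⁻¹ + (t i)⁻¹ = 1)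
    {F G : (Fin n → ℝ) → ℝ≥0∞} (hF : Measurable F) (hG : Measurable G) :
    ∫⁻ x, F x * G x ≤ amalgamENorm p s F * amalgamENorm q t G := by
  refine le_trans ?_ (lintegral_mul_le_mixedENorm (μ := Measure.count) hst
    Measurable.of_discrete Measurable.of_discrete)
  rw [lintegral_pi_count, lintegral_eq_tsum_cube (F := fun x => F x * G x) (hF.mul hG)]
  refine ENNReal.tsum_le_tsum fun k => ?_
  refine le_trans (le_of_eq ?_) (lintegral_mul_le_mixedENorm (μ := volume) hpq
    (hF.indicator (measurableSet_cube 1 k)) (hG.indicator (measurableSet_cube 1 k)))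
  rw [← volume_pi]
  refine lintegral_congr fun x => ?_
  by_cases hx : x ∈ cube 1 k <;> simp [hx]

/-- Dominated convergence used twice: on each cube, where the norm of G is finite, and then over the
lattice of cubes. -/
theorem tendsto_amalgamENorm_zero {q t : Fin n → ℝ≥0∞}
    (hq : ∀ i, 1 ≤ q i) (hq' : ∀ i, q i ≠ ∞) (ht : ∀ i, 1 ≤ t i) (ht' : ∀ i, t i ≠ ∞)
    {ι : Type} {l : Filter ι} [l.IsCountablyGenerated] {F : ι → (Fin n → ℝ) → ℝ≥0∞}
    {G : (Fin n → ℝ) → ℝ≥0∞} (hF : ∀ m, Measurable (F m)) (hG : Measurable G)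
    (hFG : ∀ m, F m ≤ G) (hG' : amalgamENorm q t G ≠ ∞)
    (h : ∀ᵐ x, Tendsto (fun m => F m x) l (𝓝 0)) :
    Tendsto (fun m => amalgamENorm q t (F m)) l (𝓝 0) := by
  refine tendsto_mixedENorm_zero ht ht' (fun m => Measurable.of_discrete) Measurable.of_discrete
    (fun m k => mixedENorm_mono q fun x => Set.indicator_le_indicator (hFG m x)) hG' ?_
  filter_upwards [ae_lt_top_of_mixedENorm_ne_top ht Measurable.of_discrete hG'] with k hk
  refine tendsto_mixedENorm_zero hq hq' (fun m => (hF m).indicator (measurableSet_cube 1 k))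
    (hG.indicator (measurableSet_cube 1 k))
    (fun m x => Set.indicator_le_indicator (hFG m x)) hk.ne ?_
  rw [← volume_pi]
  filter_upwards [h] with x hx
  by_cases hxk : x ∈ cube 1 k
  · simpa [hxk] using hx
  · simpa [hxk] using tendsto_const_nhds

/-- A sequence d almost norms the family of cube norms, and a function G k almost norms F on the
k-th cube. Gluing the d k * G k along the disjoint cubes gives the required function. -/
theorem exists_amalgamENorm_le_one_lt_lintegral {p s q t : Fin n → ℝ≥0∞}
    (hpq : ∀ i, (p i)⁻¹ + (q i)⁻¹ = 1) (hst : ∀ i, (s i)⁻¹ + (t i)⁻¹ = 1)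
    {F : (Fin n → ℝ) → ℝ≥0∞} (hF : Measurable F) {c : ℝ≥0∞} (hc : c < amalgamENorm p s F) :
    ∃ G : (Fin n → ℝ) → ℝ≥0∞, Measurable G ∧ amalgamENorm q t G ≤ 1 ∧ c < ∫⁻ x, F x * G x := by
  obtain ⟨d, hd, hd1, hcd⟩ := exists_mixedENorm_le_one_lt_lintegral hst Measurable.of_discrete hc
  -- The cube norms may be infinite and need not be attained. Each is approached from below by an
  -- increasing sequence, so that monotone convergence over k selects one index m for all cubes. A
  -- zero norm is separate, having nothing strictly below it.
  have hu : ∀ k : Fin n → ℤ, ∃ u : ℕ → ℝ≥0∞, Monotone u ∧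
      ⨆ m, u m = mixedENorm volume p ((cube 1 k).indicator F) ∧
      ∀ m, ∃ G : (Fin n → ℝ) → ℝ≥0∞, Measurable G ∧ mixedENorm volume q G ≤ 1 ∧
        u m ≤ ∫⁻ x, (cube 1 k).indicator F x * G x := fun k => by
    rcases eq_or_ne (mixedENorm volume p ((cube 1 k).indicator F)) 0 with h0 | h0
    · refine ⟨fun _ => 0, monotone_const, by simp [h0], fun m => ⟨fun _ => 0, measurable_const,
        ?_, zero_le⟩⟩
      have := mixedENorm_const_mul (μ := (volume : Measure ℝ)) q (c := 0) ENNReal.zero_ne_top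
        (fun _ => 0)
      simp only [zero_mul] at this
      rw [this]
      exact zero_le
    · obtain ⟨u, hu, hu', hlim⟩ := exists_seq_strictMono_tendsto' (pos_iff_ne_zero.2 h0)
      refine ⟨u, hu.monotone, iSup_eq_of_tendsto hu.monotone hlim, fun m => ?_⟩
      obtain ⟨G, hG, hG1, hlt⟩ := exists_mixedENorm_le_one_lt_lintegral (μ := volume) hpq
        (hF.indicator (measurableSet_cube 1 k)) (hu' m).2
      exact ⟨G, hG, hG1, hlt.le⟩
  choose u hmono hsup H using hu
  choose G hG hG1 huG using H
  simp only [← hsup, ENNReal.iSup_mul] at hcd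
  rw [lintegral_iSup (f := fun m k => u k m * d k) (fun m => Measurable.of_discrete)
    (fun a b hab k => mul_le_mul_left (hmono k hab) _)] at hcd
  obtain ⟨m, hm⟩ := lt_iSup_iff.1 hcd
  rw [lintegral_pi_count] at hm
  have hmeas : Measurable fun x => ∑' k, (cube 1 k).indicator (fun x => d k * G k m x) x :=
    Measurable.tsum fun k => ((hG k m).const_mul _).indicator (measurableSet_cube 1 k)
  refine ⟨_, hmeas, ?_, ?_⟩
  · refine le_trans (mixedENorm_mono t fun k => ?_) hd1
    have e : (cube 1 k).indicator
        (fun x => ∑' k, (cube 1 k).indicator (fun x => d k * G k m x) x)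
        ≤ fun x => d k * G k m x := fun x => by
      by_cases hx : x ∈ cube 1 k
      · rw [Set.indicator_of_mem hx, tsum_indicator_cube _ hx]
      · simp [hx]
    refine (mixedENorm_mono q e).trans ?_
    by_cases hdk : d k = ∞
    · rw [hdk]; exact le_top
    · rw [mixedENorm_const_mul q hdk]
      exact mul_le_of_le_one_right zero_le (hG1 k m)
  · rw [lintegral_eq_tsum_cube (F := fun x => F x * _) (hF.mul hmeas)]
    refine hm.trans_le (ENNReal.tsum_le_tsum fun k => ?_)
    calc u k m * d k ≤ (∫⁻ x, (cube 1 k).indicator F x * G k m x) * d k := by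
          gcongr; exact huG k m
      _ = ∫⁻ x, (cube 1 k).indicator F x * G k m x * d k := by
          rw [lintegral_mul_const]
          exact (hF.indicator (measurableSet_cube 1 k)).mul (hG k m)
      _ = _ := lintegral_congr fun x => by
          by_cases hx : x ∈ cube 1 k
          · rw [Set.indicator_of_mem hx, Set.indicator_of_mem hx, tsum_indicator_cube _ hx]
            ring
          · simp [hx]

/-- As v vanishes nowhere, min(G, m v) increases to G, so some truncation still exceeds c. This
keeps the test functions inside the class on which a functional is known to be an integral. -/
theorem exists_amalgamENorm_le_one_le_mul_lt_lintegral {p s q t : Fin n → ℝ≥0∞}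
    (hpq : ∀ i, (p i)⁻¹ + (q i)⁻¹ = 1) (hst : ∀ i, (s i)⁻¹ + (t i)⁻¹ = 1)
    {F v : (Fin n → ℝ) → ℝ≥0∞} (hF : Measurable F) (hv : Measurable v) (hv0 : ∀ x, v x ≠ 0)
    {c : ℝ≥0∞} (hc : c < amalgamENorm p s F) :
    ∃ G : (Fin n → ℝ) → ℝ≥0∞, ∃ m : ℕ, Measurable G ∧ (∀ x, G x ≤ m * v x) ∧
      amalgamENorm q t G ≤ 1 ∧ c < ∫⁻ x, F x * G x := by
  obtain ⟨G, hG, hG1, hcG⟩ := exists_amalgamENorm_le_one_lt_lintegral hpq hst hF hc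
  have hsup : ∀ x, F x * G x = ⨆ m : ℕ, F x * min (G x) (m * v x) := fun x => by
    rw [← ENNReal.mul_iSup]
    congr 1
    refine le_antisymm (le_of_forall_lt fun d hd => ?_) (iSup_le fun m => min_le_left _ _)
    obtain ⟨m, hm⟩ := ENNReal.exists_nat_mul_gt (hv0 x) (hd.trans_le le_top).ne
    exact (lt_min hd hm).trans_le (le_iSup (fun m : ℕ => min (G x) (m * v x)) m)
  simp only [hsup] at hcG
  rw [lintegral_iSup (f := fun (m : ℕ) x => F x * min (G x) (m * v x)) (fun m => hF.mul (hG.min (hv.const_mul _)))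
    (fun a b hab x => by dsimp only; gcongr)] at hcG
  obtain ⟨m, hm⟩ := lt_iSup_iff.1 hcG
  exact ⟨fun x => min (G x) (m * v x), m, hG.min (hv.const_mul _), fun x => min_le_right _ _,
    (amalgamENorm_mono q t fun x => min_le_left _ _).trans hG1, hm⟩

/-! ### Behaviour of norms and integrals under dilation. -/

section dilation

theorem eLpNorm_comp_mul_left {r : ℝ} (hr : 0 < r) (q : ℝ≥0∞) (f : ℝ → ℝ≥0∞) :
    eLpNorm (fun t => f (r * t)) q volume
      = ENNReal.ofReal (r ^ (-q⁻¹.toReal)) * eLpNorm f q volume := by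
  have hemb : MeasurableEmbedding fun t : ℝ => r * t :=
    (Homeomorph.mulLeft₀ r hr.ne').measurableEmbedding
  have h1 := hemb.eLpNorm_map_measure (g := f) (p := q) (μ := volume)
  rw [Real.map_volume_mul_left hr.ne', eLpNorm_smul_measure_of_ne_zero
    (by simp [hr.ne'])] at h1
  change eLpNorm (f ∘ fun t : ℝ => r * t) q volume = _
  rw [← h1, smul_eq_mul, abs_of_pos (inv_pos.2 hr), ENNReal.ofReal_rpow_of_pos (inv_pos.2 hr),
    Real.inv_rpow hr.le, Real.rpow_neg hr.le, one_div]

theorem mixedENorm_comp_smul {r : ℝ} (hr : 0 < r) (q : Fin n → ℝ≥0∞)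
    (F : (Fin n → ℝ) → ℝ≥0∞) :
    mixedENorm volume q (fun x => F (r • x))
      = ENNReal.ofReal (r ^ (-∑ i, (q i)⁻¹.toReal)) * mixedENorm volume q F := by
  induction n with
  | zero =>
    simp only [mixedENorm, Finset.univ_eq_empty, Finset.sum_empty, neg_zero, Real.rpow_zero,
      ENNReal.ofReal_one, one_mul]
    congr 1
    exact Subsingleton.elim _ _
  | succ n ih =>
    have e : ∀ (t : ℝ) (y : Fin n → ℝ),
        r • (Fin.cons t y : Fin (n + 1) → ℝ) = Fin.cons (r * t) (r • y) := fun t y => by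
      ext i
      refine Fin.cases ?_ (fun j => ?_) i <;> simp
    simp only [mixedENorm, e]
    have e2 : ∀ y : Fin n → ℝ, eLpNorm (fun t => F (Fin.cons (r * t) (r • y))) (q 0) volume
        = ENNReal.ofReal (r ^ (-(q 0)⁻¹.toReal))
          * eLpNorm (fun t => F (Fin.cons t (r • y))) (q 0) volume := fun y =>
      eLpNorm_comp_mul_left hr (q 0) fun t => F (Fin.cons t (r • y))
    simp only [e2]
    rw [mixedENorm_const_mul _ ENNReal.ofReal_ne_top,
      ih (fun i => q i.succ) (fun y => eLpNorm (fun t => F (Fin.cons t y)) (q 0) volume),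
      ← mul_assoc, ← ENNReal.ofReal_mul (by positivity), ← Real.rpow_add hr, Fin.sum_univ_succ]
    congr 3
    ring

theorem smul_mem_cube_iff {r : ℝ} (hr : 0 < r) {x : Fin n → ℝ} {k : Fin n → ℤ} :
    r • x ∈ cube r k ↔ x ∈ cube 1 k := by
  simp [cube, mul_le_mul_iff_right₀ hr, mul_lt_mul_iff_right₀ hr]

/-- Dilation by r carries unit cubes to the cubes of side r with the same index, so only the inner
norms acquire a power of r. This reduces every scale to r = 1. -/
theorem amalgamENorm_comp_smul {r : ℝ} (hr : 0 < r) (p s : Fin n → ℝ≥0∞)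
    (g : (Fin n → ℝ) → ℂ) :
    amalgamENorm p s (fun x => ‖g (r • x)‖ₑ)
      = ENNReal.ofReal (r ^ (-∑ i, (p i)⁻¹.toReal)) * scaledENorm r p s g := by
  unfold amalgamENorm scaledENorm
  rw [← mixedENorm_const_mul s ENNReal.ofReal_ne_top]
  congr 1
  funext k
  rw [← mixedENorm_comp_smul hr]
  congr 1
  funext x
  by_cases hx : x ∈ cube 1 k
  · simp [hx, (smul_mem_cube_iff hr).2 hx]
  · simp [hx, mt (smul_mem_cube_iff hr).1 hx]

theorem lintegral_comp_smul {r : ℝ} (hr : 0 < r) (F : (Fin n → ℝ) → ℝ≥0∞) :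
    ∫⁻ x, F x = ENNReal.ofReal (r ^ (n : ℝ)) * ∫⁻ x, F (r • x) := by
  have hemb : MeasurableEmbedding fun x : Fin n → ℝ => r • x :=
    (Homeomorph.smulOfNeZero r hr.ne').measurableEmbedding
  have h1 := hemb.lintegral_map (μ := volume) F
  rw [Measure.map_addHaar_smul _ hr.ne', lintegral_smul_measure] at h1
  rw [← h1, smul_eq_mul, ← mul_assoc, ← ENNReal.ofReal_mul (by positivity)]
  rw [abs_of_pos (by positivity), Module.finrank_fintype_fun_eq_card, Fintype.card_fin,
    Real.rpow_natCast, mul_inv_cancel₀ (by positivity), ENNReal.ofReal_one, one_mul]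

/-- The Jacobian r^n and the normalization r^(-n/β) combine to r^(n/α). -/
theorem lintegral_dilate_mul {α β : ℝ≥0∞} (hαβ : α⁻¹ + β⁻¹ = 1) {r : ℝ} (hr : 0 < r)
    (b : (Fin n → ℝ) → ℂ) (F : (Fin n → ℝ) → ℝ≥0∞) :
    ∫⁻ x, ‖dilate β r b x‖ₑ * F x
      = ENNReal.ofReal (r ^ ((n : ℝ) * α⁻¹.toReal)) * ∫⁻ y, F (r • y) * ‖b y‖ₑ := by
  have h1 : α⁻¹.toReal + β⁻¹.toReal = 1 := by
    have hα : α⁻¹ ≠ ∞ := fun h => by simp [h] at hαβ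
    have hβ : β⁻¹ ≠ ∞ := fun h => by simp [h] at hαβ
    rw [← ENNReal.toReal_add hα hβ, hαβ, ENNReal.toReal_one]
  have hpos : 0 < r ^ (-((n : ℝ) * β⁻¹.toReal)) := by positivity
  have e : ∀ y, ‖dilate β r b (r • y)‖ₑ * F (r • y)
      = ENNReal.ofReal (r ^ (-((n : ℝ) * β⁻¹.toReal))) * (F (r • y) * ‖b y‖ₑ) := fun y => by
    simp only [dilate, inv_smul_smul₀ hr.ne', enorm_mul]
    rw [← ofReal_norm ((r ^ (-((n : ℝ) * β⁻¹.toReal)) : ℝ) : ℂ), Complex.norm_real,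
      Real.norm_of_nonneg hpos.le]
    ring
  rw [lintegral_comp_smul hr]
  simp only [e]
  rw [lintegral_const_mul' _ _ ENNReal.ofReal_ne_top, ← mul_assoc,
    ← ENNReal.ofReal_mul (by positivity), ← Real.rpow_add hr]
  congr 3
  linear_combination (-(n : ℝ)) * h1

end dilation

/-! ### A positive weight of finite amalgam norm. -/

section weight

/-- The terms are at most 1, so raising them to a power t ≥ 1 decreases them. -/
theorem eLpNorm_count_le_one {t : ℝ≥0∞} (ht : 1 ≤ t) {ε : ℤ → ℝ≥0}
    (hε : ∑' j, (ε j : ℝ≥0∞) ≤ 1) :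
    eLpNorm (fun j => (ε j : ℝ≥0∞)) t Measure.count ≤ 1 := by
  have h1 : ∀ j, (ε j : ℝ≥0∞) ≤ 1 := fun j => (ENNReal.le_tsum j).trans hε
  by_cases htop : t = ∞
  · subst htop
    rw [eLpNorm_top_ennreal]
    exact essSup_le_of_ae_le _ (Eventually.of_forall h1)
  · have h0 : t ≠ 0 := (zero_lt_one.trans_le ht).ne'
    have ht' : 1 ≤ t.toReal := by
      simpa using ENNReal.toReal_mono htop ht
    rw [eLpNorm_ennreal h0 htop, lintegral_count]
    refine ENNReal.rpow_le_one (le_trans (ENNReal.tsum_le_tsum fun j => ?_) hε) (by positivity)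
    calc (ε j : ℝ≥0∞) ^ t.toReal ≤ (ε j : ℝ≥0∞) ^ (1 : ℝ) :=
          ENNReal.rpow_le_rpow_of_exponent_ge (h1 j) ht'
      _ = ε j := ENNReal.rpow_one _

theorem mixedENorm_indicator_cube_le (q : Fin n → ℝ≥0∞) (k : Fin n → ℤ) :
    mixedENorm volume q ((cube 1 k).indicator fun _ => 1) ≤ 1 := by
  have e : (cube 1 k).indicator (fun _ => (1 : ℝ≥0∞)) = fun x =>
      ∏ i, (Set.Ico (k i : ℝ) (k i + 1)).indicator (fun _ => (1 : ℝ≥0∞)) (x i) := by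
    classical
    funext x
    by_cases hx : x ∈ cube 1 k
    · rw [Set.indicator_of_mem hx]
      have h1 : ∀ i, x i ∈ Set.Ico (k i : ℝ) (k i + 1) := fun i => by simpa using hx i
      simp only [Set.indicator_of_mem (h1 _), Finset.prod_const_one]
    · rw [Set.indicator_of_notMem hx]
      obtain ⟨i, hi⟩ := not_forall.1 hx
      have h1 : x i ∉ Set.Ico (k i : ℝ) (k i + 1) := fun h => hi (by simpa using h)
      exact (Finset.prod_eq_zero (Finset.mem_univ i) (Set.indicator_of_notMem h1 _)).symm
  have hle : ∀ i, eLpNorm ((Set.Ico (k i : ℝ) (k i + 1)).indicator fun _ => (1 : ℝ≥0∞)) (q i)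
      volume ≤ 1 := fun i => by
    refine (eLpNorm_indicator_const_le _ _).trans ?_
    simp
  rw [e, mixedENorm_prod q _ (fun i t => ?_) (fun i => ne_top_of_le_ne_top ENNReal.one_ne_top (hle i))]
  · exact Finset.prod_le_one' fun i _ => hle i
  · exact ne_top_of_le_ne_top ENNReal.one_ne_top (Set.indicator_le_self _ _ _)

/-- A positive bounded weight of finite amalgam norm that is locally bounded below. -/
theorem exists_weight (q : Fin n → ℝ≥0∞) {t : Fin n → ℝ≥0∞} (ht : ∀ i, 1 ≤ t i) :
    ∃ w : (Fin n → ℝ) → ℝ≥0, Measurable w ∧ (∀ x, 0 < w x) ∧ (∀ x, w x ≤ 1) ∧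
      (∀ x, ∃ δ > 0, ∀ᶠ y in 𝓝 x, δ ≤ w y) ∧ amalgamENorm q t (fun x => w x) ≤ 1 := by
  obtain ⟨ε, hε, hsum⟩ := ENNReal.exists_pos_sum_of_countable one_ne_zero ℤ
  have h1 : ∀ j, ε j ≤ 1 := fun j => by
    exact_mod_cast (ENNReal.le_tsum (f := fun j => (ε j : ℝ≥0∞)) j).trans hsum.le
  -- The weight is constant on unit cubes, and its values are products of a positive summable
  -- sequence. Its amalgam norm thus factors into one-dimensional norms of ε, each at most 1.
  refine ⟨fun x => ∏ i, ε ⌊x i⌋, ?_, fun x => Finset.prod_pos fun i _ => hε _,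
    fun x => Finset.prod_le_one' fun i _ => h1 _, fun x => ?_, ?_⟩
  · exact Finset.measurable_prod _ fun i _ =>
      (Measurable.of_discrete (f := ε)).comp (Int.measurable_floor.comp (measurable_pi_apply i))
  -- Within distance 1 of x each integer part changes by at most one, so only finitely many values
  -- of w occur.
  · refine ⟨∏ i, min (ε (⌊x i⌋ - 1)) (min (ε ⌊x i⌋) (ε (⌊x i⌋ + 1))),
      Finset.prod_pos fun i _ => lt_min (hε _) (lt_min (hε _) (hε _)), ?_⟩
    have hev : ∀ᶠ y : Fin n → ℝ in 𝓝 x, ∀ i, y i ∈ Set.Ioo (x i - 1) (x i + 1) :=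
      eventually_all.2 fun i => (continuous_apply i).continuousAt
        (Ioo_mem_nhds (by linarith) (by linarith))
    filter_upwards [hev] with y hy
    refine Finset.prod_le_prod' fun i _ => ?_
    have h2 : ⌊x i⌋ - 1 ≤ ⌊y i⌋ := by
      rw [Int.le_floor]
      push_cast
      linarith [(hy i).1, Int.floor_le (x i)]
    have h3 : ⌊y i⌋ < ⌊x i⌋ + 2 := by
      rw [Int.floor_lt]
      push_cast
      linarith [(hy i).2, Int.lt_floor_add_one (x i)]
    have h4 : ⌊y i⌋ = ⌊x i⌋ - 1 ∨ ⌊y i⌋ = ⌊x i⌋ ∨ ⌊y i⌋ = ⌊x i⌋ + 1 := by omega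
    rcases h4 with h4 | h4 | h4 <;> rw [h4] <;> simp
  · have hle : ∀ i, eLpNorm (fun j => (ε j : ℝ≥0∞)) (t i) Measure.count ≤ 1 := fun i =>
      eLpNorm_count_le_one (ht i) hsum.le
    calc amalgamENorm q t (fun x => ((∏ i, ε ⌊x i⌋ : ℝ≥0) : ℝ≥0∞))
        ≤ mixedENorm Measure.count t fun k => ∏ i, (ε (k i) : ℝ≥0∞) := by
          refine mixedENorm_mono t fun k => ?_
          have e : (cube 1 k).indicator (fun x => ((∏ i, ε ⌊x i⌋ : ℝ≥0) : ℝ≥0∞))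
              = fun x => (∏ i, (ε (k i) : ℝ≥0∞)) * (cube 1 k).indicator (fun _ => 1) x := by
            funext x
            by_cases hx : x ∈ cube 1 k
            · rw [Set.indicator_of_mem hx, Set.indicator_of_mem hx, mem_cube_one_iff.1 hx]
              simp
            · simp [hx]
          rw [e, mixedENorm_const_mul q (ENNReal.prod_ne_top fun i _ => ENNReal.coe_ne_top)]
          exact mul_le_of_le_one_right zero_le (mixedENorm_indicator_cube_le q k)
      _ = ∏ i, eLpNorm (fun j => (ε j : ℝ≥0∞)) (t i) Measure.count :=
          mixedENorm_prod t (fun _ j => (ε j : ℝ≥0∞)) (fun _ _ => ENNReal.coe_ne_top)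
            fun i => ne_top_of_le_ne_top ENNReal.one_ne_top (hle i)
      _ ≤ 1 := Finset.prod_le_one' fun i _ => hle i

end weight

/-! ### Pairing blocks with functions: upper bound and almost norming blocks. -/

section pairing
variable {p s q t : Fin n → ℝ≥0∞} {α β : ℝ≥0∞}

theorem dilate_congr_ae (β : ℝ≥0∞) {r : ℝ} (hr : 0 < r) {b b' : (Fin n → ℝ) → ℂ}
    (h : b =ᵐ[volume] b') : dilate β r b =ᵐ[volume] dilate β r b' := by
  filter_upwards [(Measure.quasiMeasurePreserving_smul volume (inv_ne_zero hr.ne')).ae h] with x hx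
  simp only [dilate]
  rw [hx]

theorem lintegral_dilate_mul_le (hpq : ∀ i, (p i)⁻¹ + (q i)⁻¹ = 1)
    (hst : ∀ i, (s i)⁻¹ + (t i)⁻¹ = 1) (hαβ : α⁻¹ + β⁻¹ = 1) {r : ℝ} (hr : 0 < r)
    {b g : (Fin n → ℝ) → ℂ} (hb : AEStronglyMeasurable b) (hg : Measurable g) :
    ∫⁻ x, ‖dilate β r b x‖ₑ * ‖g x‖ₑ ≤ scaledENorm 1 q t b * fofanaENorm p s α g := by
  have hgr : Measurable fun y : Fin n → ℝ => ‖g (r • y)‖ₑ :=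
    (hg.comp (measurable_const_smul r)).enorm
  rw [lintegral_dilate_mul hαβ hr, scaledENorm_congr_ae 1 q t hb.ae_eq_mk, scaledENorm_one_eq]
  have e : ∫⁻ y, ‖g (r • y)‖ₑ * ‖b y‖ₑ = ∫⁻ y, ‖g (r • y)‖ₑ * ‖hb.mk b y‖ₑ :=
    lintegral_congr_ae (by filter_upwards [hb.ae_eq_mk] with y hy; rw [← hy])
  rw [e]
  refine (mul_le_mul_right (lintegral_mul_le_amalgamENorm hpq hst hgr
    hb.stronglyMeasurable_mk.measurable.enorm) _).trans ?_
  rw [amalgamENorm_comp_smul hr, mul_comm (_ * scaledENorm r p s g), mul_left_comm, ← mul_assoc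
    (ENNReal.ofReal _), ← ENNReal.ofReal_mul (by positivity), ← Real.rpow_add hr, ← sub_eq_add_neg]
  gcongr
  exact le_iSup₂ (f := fun (r : ℝ) (_ : 0 < r) => ENNReal.ofReal
    (r ^ ((n : ℝ) * α⁻¹.toReal - ∑ i, (p i)⁻¹.toReal)) * scaledENorm r p s g) r hr

/-- On a compact set the positive part of |f| - D, with D the series of absolute values, is at most
the modulus of every remainder f - ∑_{j<J}. The integrals of these tend to 0, so no almost
everywhere convergent subsequence is needed. -/
theorem IsBlockDecomposition.ae_enorm_le {f : (Fin n → ℝ) → ℂ} {c : ℕ → ℂ} {r : ℕ → ℝ}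
    {b : ℕ → (Fin n → ℝ) → ℂ} (h : IsBlockDecomposition q t β f c r b)
    (hf : AEStronglyMeasurable f) :
    ∀ᵐ x, ‖f x‖ₑ ≤ ∑' j, ‖c j‖ₑ * ‖dilate β (r j) (b j) x‖ₑ := by
  set D : (Fin n → ℝ) → ℝ≥0∞ := fun x => ∑' j, ‖c j‖ₑ * ‖dilate β (r j) (b j) x‖ₑ with hD
  have hDm : AEMeasurable D := AEMeasurable.tsum fun j =>
    (aestronglyMeasurable_dilate β (h.pos j) (h.locInt j).aestronglyMeasurable).enorm.const_mul _
  have key : ∀ K : Set (Fin n → ℝ), IsCompact K → ∀ᵐ x ∂volume.restrict K, ‖f x‖ₑ ≤ D x := by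
    intro K hK
    have h0 : ∫⁻ x in K, (‖f x‖ₑ - D x) = 0 := by
      refine le_antisymm (ge_of_tendsto' (h.tendsto K hK) fun J => lintegral_mono fun x => ?_)
        zero_le
      refine tsub_le_iff_right.2 ?_
      calc ‖f x‖ₑ = ‖(f x - ∑ j ∈ Finset.range J, c j * dilate β (r j) (b j) x)
            + ∑ j ∈ Finset.range J, c j * dilate β (r j) (b j) x‖ₑ := by rw [sub_add_cancel]
        _ ≤ _ := enorm_add_le _ _
        _ ≤ _ := by
          gcongr
          refine (enorm_sum_le _ _).trans ?_
          simp only [enorm_mul]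
          exact ENNReal.sum_le_tsum _
    rw [lintegral_eq_zero_iff' (f := fun x => ‖f x‖ₑ - D x) (hf.enorm.sub hDm).restrict] at h0
    filter_upwards [h0] with x hx
    exact tsub_eq_zero_iff_le.1 hx
  have hall := ae_all_iff.2 fun N : ℕ =>
    (ae_restrict_iff' (measurableSet_closedBall)).1
      (key (Metric.closedBall (0 : Fin n → ℝ) N) (isCompact_closedBall _ _))
  filter_upwards [hall] with x hx
  obtain ⟨N, hN⟩ := exists_nat_ge ‖x‖
  exact hx N (by simpa using hN)

theorem IsBlockDecomposition.lintegral_mul_le (hpq : ∀ i, (p i)⁻¹ + (q i)⁻¹ = 1)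
    (hst : ∀ i, (s i)⁻¹ + (t i)⁻¹ = 1) (hαβ : α⁻¹ + β⁻¹ = 1)
    {f g : (Fin n → ℝ) → ℂ} {c : ℕ → ℂ} {r : ℕ → ℝ}
    {b : ℕ → (Fin n → ℝ) → ℂ} (h : IsBlockDecomposition q t β f c r b)
    (hf : AEStronglyMeasurable f) (hg : Measurable g) :
    ∫⁻ x, ‖f x * g x‖ₑ ≤ ENNReal.ofReal (∑' j, ‖c j‖) * fofanaENorm p s α g := by
  have hm : ∀ j, AEMeasurable fun x => ‖dilate β (r j) (b j) x‖ₑ * ‖g x‖ₑ := fun j =>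
    (aestronglyMeasurable_dilate β (h.pos j) (h.locInt j).aestronglyMeasurable).enorm.mul
      hg.enorm.aemeasurable
  calc ∫⁻ x, ‖f x * g x‖ₑ
      ≤ ∫⁻ x, ∑' j, ‖c j‖ₑ * (‖dilate β (r j) (b j) x‖ₑ * ‖g x‖ₑ) := by
        refine lintegral_mono_ae ?_
        filter_upwards [h.ae_enorm_le hf] with x hx
        simp only [← mul_assoc]
        rw [enorm_mul, ENNReal.tsum_mul_right]
        gcongr
    _ = ∑' j, ‖c j‖ₑ * ∫⁻ x, ‖dilate β (r j) (b j) x‖ₑ * ‖g x‖ₑ := by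
        rw [lintegral_tsum fun j => (hm j).const_mul _]
        simp only [lintegral_const_mul'' _ (hm _)]
    _ ≤ ∑' j, ‖c j‖ₑ * fofanaENorm p s α g := by
        refine ENNReal.tsum_le_tsum fun j => ?_
        gcongr
        refine (lintegral_dilate_mul_le hpq hst hαβ (h.pos j)
          (h.locInt j).aestronglyMeasurable hg).trans ?_
        exact mul_le_of_le_one_left zero_le (h.norm_le j)
    _ = _ := by
        rw [ENNReal.tsum_mul_right, ENNReal.ofReal_tsum_of_nonneg (fun _ => norm_nonneg _)
          h.summable]
        simp

/-- Almost norming blocks: a bound for the pairings of `g` with the dilates of all functions in the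
unit ball that are dominated by a multiple of a dilate of `v` is a bound for the norm of `g`. -/
theorem fofanaENorm_le_of_forall_pairing_le (hpq : ∀ i, (p i)⁻¹ + (q i)⁻¹ = 1)
    (hst : ∀ i, (s i)⁻¹ + (t i)⁻¹ = 1) (hαβ : α⁻¹ + β⁻¹ = 1) {g : (Fin n → ℝ) → ℂ}
    (hg : Measurable g) {v : (Fin n → ℝ) → ℝ≥0} (hv : Measurable v) (hv0 : ∀ x, 0 < v x)
    {C : ℝ≥0∞} (H : ∀ r : ℝ, 0 < r → ∀ b : (Fin n → ℝ) → ℂ, Measurable b → ∀ m : ℕ,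
      (∀ y, ‖b y‖ ≤ m * v (r • y)) → scaledENorm 1 q t b ≤ 1 →
      Integrable (fun x => dilate β r b x * g x) ∧ ‖∫ x, dilate β r b x * g x‖ₑ ≤ C) :
    fofanaENorm p s α g ≤ C := by
  refine iSup₂_le fun r hr => ?_
  have hA : ENNReal.ofReal (r ^ ((n : ℝ) * α⁻¹.toReal - ∑ i, (p i)⁻¹.toReal)) * scaledENorm r p s g
      = ENNReal.ofReal (r ^ ((n : ℝ) * α⁻¹.toReal)) * amalgamENorm p s fun x => ‖g (r • x)‖ₑ := by
    rw [amalgamENorm_comp_smul hr, ← mul_assoc, ← ENNReal.ofReal_mul (by positivity),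
      ← Real.rpow_add hr, ← sub_eq_add_neg]
  rw [hA, mul_comm]
  set κ := ENNReal.ofReal (r ^ ((n : ℝ) * α⁻¹.toReal)) with hκ
  have hκ0 : κ ≠ 0 := by simp only [hκ, ne_eq, ENNReal.ofReal_eq_zero, not_le]; positivity
  have hκt : κ ≠ ∞ := ENNReal.ofReal_ne_top
  rw [← ENNReal.le_div_iff_mul_le (Or.inl hκ0) (Or.inl hκt)]
  refine le_of_forall_lt fun c hc => ?_
  have hgr : Measurable fun y : Fin n → ℝ => g (r • y) := hg.comp (measurable_const_smul r)
  have hvr : Measurable fun y : Fin n → ℝ => (v (r • y) : ℝ≥0∞) :=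
    (hv.comp (measurable_const_smul r)).coe_nnreal_ennreal
  obtain ⟨G, m, hG, hGm, hG1, hcG⟩ := exists_amalgamENorm_le_one_le_mul_lt_lintegral hpq hst
    hgr.enorm hvr (fun y => by simpa using (hv0 (r • y)).ne') hc
  have hGt : ∀ y, G y ≠ ∞ := fun y => ne_top_of_le_ne_top
    (ENNReal.mul_ne_top (ENNReal.natCast_ne_top m) ENNReal.coe_ne_top) (hGm y)
  -- The conjugate phase of g (0 where g vanishes, as 0 / 0 = 0). With b = G σ the product of g and
  -- the dilate of b is nonnegative, so the modulus of its integral is the integral of its modulus.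
  set σ : (Fin n → ℝ) → ℂ := fun y => (starRingEnd ℂ) (g (r • y)) / ‖g (r • y)‖ with hσ
  have hσm : Measurable σ := (Complex.continuous_conj.measurable.comp hgr).div
    (Complex.measurable_ofReal.comp hgr.norm)
  have hσ1 : ∀ y, ‖σ y‖ ≤ 1 := fun y => by
    simp only [hσ, norm_div, Complex.norm_conj, Complex.norm_real, norm_norm]
    exact div_self_le_one _
  have hσg : ∀ y, σ y * g (r • y) = (‖g (r • y)‖ : ℝ) := fun y => by
    by_cases h0 : g (r • y) = 0
    · simp [h0]
    · have : (‖g (r • y)‖ : ℂ) ≠ 0 := by simpa using h0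
      simp only [hσ]
      rw [div_mul_eq_mul_div, Complex.conj_mul', sq, mul_div_assoc, div_self this, mul_one]
  set b : (Fin n → ℝ) → ℂ := fun y => ((G y).toReal : ℂ) * σ y with hb
  have hbG : ∀ y, ‖b y‖ ≤ (G y).toReal := fun y => by
    simp only [hb, norm_mul, Complex.norm_real, Real.norm_of_nonneg ENNReal.toReal_nonneg]
    exact mul_le_of_le_one_right ENNReal.toReal_nonneg (hσ1 y)
  have hbG' : ∀ y, ‖b y‖ₑ ≤ G y := fun y => by
    rw [← ofReal_norm]
    exact ENNReal.ofReal_le_of_le_toReal (hbG y)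
  obtain ⟨hint, hle⟩ := H r hr b
    ((Complex.measurable_ofReal.comp hG.ennreal_toReal).mul hσm) m (fun y => by
      refine (hbG y).trans ?_
      have := ENNReal.toReal_mono
        (ENNReal.mul_ne_top (ENNReal.natCast_ne_top m) ENNReal.coe_ne_top) (hGm y)
      simpa using this) (by
      rw [scaledENorm_one_eq]
      exact (amalgamENorm_mono q t hbG').trans hG1)
  rw [ENNReal.lt_div_iff_mul_lt (Or.inl hκ0) (Or.inl hκt)]
  refine lt_of_lt_of_le ?_ hle
  have hreal : ∀ x, dilate β r b x * g x = ((‖dilate β r b x * g x‖ : ℝ) : ℂ) := fun x => by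
    have e : dilate β r b x * g x = ((r ^ (-((n : ℝ) * β⁻¹.toReal)) * ((G (r⁻¹ • x)).toReal
        * ‖g x‖) : ℝ) : ℂ) := by
      have := hσg (r⁻¹ • x)
      rw [smul_inv_smul₀ hr.ne'] at this
      simp only [dilate, hb, mul_assoc, this]
      push_cast
      ring
    rw [e, Complex.norm_real, Real.norm_of_nonneg (by positivity)]
  have h1 : ‖∫ x, dilate β r b x * g x‖ₑ = ∫⁻ x, ‖dilate β r b x‖ₑ * ‖g x‖ₑ := by
    rw [integral_congr_ae (Eventually.of_forall hreal), integral_complex_ofReal, ← ofReal_norm,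
      Complex.norm_real, Real.norm_of_nonneg (integral_nonneg fun _ => norm_nonneg _),
      ofReal_integral_norm_eq_lintegral_enorm hint]
    simp only [enorm_mul]
  have hbg : ∀ y, ‖g (r • y)‖ₑ * ‖b y‖ₑ = ‖g (r • y)‖ₑ * G y := fun y => by
    rw [← enorm_mul, mul_comm]
    simp only [hb, mul_assoc, hσg]
    rw [enorm_mul, mul_comm, ← ofReal_norm, ← ofReal_norm, Complex.norm_real, Complex.norm_real,
      norm_norm, Real.norm_of_nonneg ENNReal.toReal_nonneg, ENNReal.ofReal_toReal (hGt y),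
      ofReal_norm]
  rw [h1, lintegral_dilate_mul hαβ hr, mul_comm]
  simp only [hbg]
  exact (ENNReal.mul_lt_mul_iff_right hκ0 hκt).2 hcG

end pairing

/-! ### Single blocks and convergence in the block space. -/

section blocks
variable {q t : Fin n → ℝ≥0∞} {β : ℝ≥0∞}

theorem locallyIntegrable_dilate (β : ℝ≥0∞) {r : ℝ} (hr : 0 < r) {b : (Fin n → ℝ) → ℂ}
    (hb : LocallyIntegrable b) : LocallyIntegrable (dilate β r b) := by
  have h1 : LocallyIntegrable b
      (Measure.map (Homeomorph.smulOfNeZero r⁻¹ (inv_ne_zero hr.ne') : (Fin n → ℝ) ≃ₜ _) volume) := by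
    have : Measure.map (Homeomorph.smulOfNeZero r⁻¹ (inv_ne_zero hr.ne') : (Fin n → ℝ) ≃ₜ _)
        (volume : Measure (Fin n → ℝ)) = _ := Measure.map_addHaar_smul volume (inv_ne_zero hr.ne')
    rw [this]
    intro x
    obtain ⟨U, hU, hbU⟩ := hb x
    refine ⟨U, hU, ?_⟩
    rw [IntegrableOn, Measure.restrict_smul]
    exact hbU.smul_measure ENNReal.ofReal_ne_top
  exact ((locallyIntegrable_map_homeomorph _).1 h1).smul
    ((r ^ (-((n : ℝ) * β⁻¹.toReal)) : ℝ) : ℂ)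

theorem dilate_one (β : ℝ≥0∞) (b : (Fin n → ℝ) → ℂ) : dilate β 1 b = b := by
  funext x
  simp [dilate]

/-- The element of the block space given by a function. -/
noncomputable def BlockSpace.mk (f : (Fin n → ℝ) → ℂ) (hf : LocallyIntegrable f)
    (h : ∃ c r b, IsBlockDecomposition q t β f c r b) : BlockSpace q t β :=
  ⟨AEEqFun.mk f hf.aestronglyMeasurable, hf.congr (AEEqFun.coeFn_mk _ _).symm, by
    obtain ⟨c, r, b, h⟩ := h
    exact ⟨c, r, b, h.congr_ae (AEEqFun.coeFn_mk _ _).symm⟩⟩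

theorem BlockSpace.coe_mk {f : (Fin n → ℝ) → ℂ} (hf : LocallyIntegrable f)
    (h : ∃ c r b, IsBlockDecomposition q t β f c r b) : (BlockSpace.mk f hf h).1 =ᵐ[volume] f :=
  AEEqFun.coeFn_mk _ _

theorem BlockSpace.ext_ae {u v : BlockSpace q t β} (h : u.1 =ᵐ[volume] v.1) : u = v :=
  Subtype.ext (AEEqFun.ext h)

theorem BlockSpace.coe_add (u v : BlockSpace q t β) :
    (u + v).1 =ᵐ[volume] fun x => u.1 x + v.1 x := AEEqFun.coeFn_add u.1 v.1

theorem BlockSpace.coe_sub (u v : BlockSpace q t β) :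
    (u - v).1 =ᵐ[volume] fun x => u.1 x - v.1 x := AEEqFun.coeFn_sub u.1 v.1

theorem BlockSpace.coe_smul (a : ℂ) (u : BlockSpace q t β) :
    (a • u).1 =ᵐ[volume] fun x => a * u.1 x := AEEqFun.coeFn_smul a u.1

/-- A single block, b / C with coefficient C. Taking C > 0 above the norm, rather than equal to it,
allows the division when b has norm zero; letting C decrease to the norm then bounds the block norm.
-/
theorem isBlockDecomposition_dilate (β : ℝ≥0∞) {r : ℝ} (hr : 0 < r) {b : (Fin n → ℝ) → ℂ}
    (hb : LocallyIntegrable b) {C : ℝ} (hC : 0 < C) (hbC : scaledENorm 1 q t b ≤ ENNReal.ofReal C) :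
    IsBlockDecomposition q t β (dilate β r b) (fun j => if j = 0 then (C : ℂ) else 0) (fun _ => r)
      (fun _ => (C : ℂ)⁻¹ • b) where
  pos _ := hr
  locInt _ := hb.smul _
  norm_le _ := by
    rw [scaledENorm_smul]
    refine (mul_le_mul_right hbC _).trans (le_of_eq ?_)
    rw [← ofReal_norm, ← ENNReal.ofReal_mul (norm_nonneg _), norm_inv, Complex.norm_real,
      Real.norm_of_nonneg hC.le, inv_mul_cancel₀ hC.ne', ENNReal.ofReal_one]
  summable := by
    refine summable_of_ne_finset_zero (s := {0}) fun j hj => ?_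
    simp [show j ≠ 0 by simpa using hj]
  tendsto K _ := by
    refine tendsto_const_nhds.congr' ?_
    filter_upwards [eventually_ge_atTop 1] with J hJ
    symm
    have hC' : (C : ℂ) ≠ 0 := by exact_mod_cast hC.ne'
    have : ∀ x, dilate β r b x - ∑ j ∈ Finset.range J, (if j = 0 then (C : ℂ) else 0)
        * dilate β r ((C : ℂ)⁻¹ • b) x = 0 := fun x => by
      simp only [ite_mul, zero_mul]
      rw [Finset.sum_ite_eq' (Finset.range J) 0, if_pos (Finset.mem_range.2 hJ)]
      simp only [dilate, Pi.smul_apply, smul_eq_mul]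
      field_simp
      ring
    simp only [this, enorm_zero, lintegral_zero]

theorem exists_isBlockDecomposition_dilate (β : ℝ≥0∞) {r : ℝ} (hr : 0 < r) {b : (Fin n → ℝ) → ℂ}
    (hb : LocallyIntegrable b) (hb' : scaledENorm 1 q t b ≠ ∞) :
    ∃ c r' b', IsBlockDecomposition q t β (dilate β r b) c r' b' :=
  ⟨_, _, _, isBlockDecomposition_dilate β hr hb (C := (scaledENorm 1 q t b).toReal + 1)
    (by positivity) (by
      rw [ENNReal.le_ofReal_iff_toReal_le hb' (by positivity)]
      linarith)⟩

theorem BlockSpace.norm_le_of_ae_eq_dilate {r : ℝ} (hr : 0 < r) {b : (Fin n → ℝ) → ℂ}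
    (hb : LocallyIntegrable b) (hb' : scaledENorm 1 q t b ≠ ∞) {u : BlockSpace q t β}
    (hu : u.1 =ᵐ[volume] dilate β r b) : ‖u‖ ≤ (scaledENorm 1 q t b).toReal := by
  refine le_of_forall_gt_imp_ge_of_dense fun C hC => ?_
  have hC0 : 0 < C := ENNReal.toReal_nonneg.trans_lt hC
  have h1 := isBlockDecomposition_dilate (q := q) (t := t) β hr hb hC0
    ((ENNReal.le_ofReal_iff_toReal_le hb' hC0.le).2 hC.le)
  refine (blockNorm_le (h1.congr_ae hu.symm)).trans (le_of_eq ?_)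
  rw [tsum_eq_single 0 fun j hj => by simp [hj]]
  simp [abs_of_pos hC0]

/-- The element `St_r b` of the block space, for `b` in the amalgam space. -/
noncomputable def BlockSpace.ofDilate {r : ℝ} (hr : 0 < r) {b : (Fin n → ℝ) → ℂ}
    (hb : LocallyIntegrable b) (hb' : scaledENorm 1 q t b ≠ ∞) : BlockSpace q t β :=
  BlockSpace.mk (dilate β r b) (locallyIntegrable_dilate β hr hb)
    (exists_isBlockDecomposition_dilate β hr hb hb')

theorem BlockSpace.coe_ofDilate {r : ℝ} (hr : 0 < r) {b : (Fin n → ℝ) → ℂ}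
    (hb : LocallyIntegrable b) (hb' : scaledENorm 1 q t b ≠ ∞) :
    (BlockSpace.ofDilate hr hb hb' : BlockSpace q t β).1 =ᵐ[volume] dilate β r b :=
  BlockSpace.coe_mk _ _

/-- Bounds the block norm of the J-th remainder by a tail of ∑ |c_j|, so convergence in L¹_loc
improves to convergence in norm. -/
theorem IsBlockDecomposition.shift {f : (Fin n → ℝ) → ℂ} {c : ℕ → ℂ} {r : ℕ → ℝ}
    {b : ℕ → (Fin n → ℝ) → ℂ} (h : IsBlockDecomposition q t β f c r b) (J : ℕ) :
    IsBlockDecomposition q t β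
      (fun x => f x - ∑ j ∈ Finset.range J, c j * dilate β (r j) (b j) x)
      (fun j => c (J + j)) (fun j => r (J + j)) (fun j => b (J + j)) where
  pos j := h.pos _
  locInt j := h.locInt _
  norm_le j := h.norm_le _
  summable := by
    simpa only [add_comm] using (summable_nat_add_iff J).2 h.summable
  tendsto K hK := by
    have h1 := (h.tendsto K hK).comp (tendsto_add_atTop_nat J)
    refine h1.congr fun M => lintegral_congr fun x => ?_
    dsimp only
    rw [add_comm M J, Finset.sum_range_add, sub_sub]

theorem BlockSpace.coe_sum {ι : Type} (S : Finset ι) (c : ι → ℂ) (u : ι → BlockSpace q t β)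
    {f : ι → (Fin n → ℝ) → ℂ} (hu : ∀ j, (u j).1 =ᵐ[volume] f j) :
    (∑ j ∈ S, c j • u j).1 =ᵐ[volume] fun x => ∑ j ∈ S, c j * f j x := by
  classical
  induction S using Finset.induction_on with
  | empty => exact AEEqFun.coeFn_zero.trans (by simp [EventuallyEq])
  | insert a S ha ih =>
    rw [Finset.sum_insert ha]
    filter_upwards [BlockSpace.coe_add (c a • u a) (∑ j ∈ S, c j • u j),
      BlockSpace.coe_smul (c a) (u a), hu a, ih] with x h1 h2 h3 h4
    rw [h1, h2, h3, h4, Finset.sum_insert ha]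

/-- The partial sums of a block decomposition converge in the block space. -/
theorem IsBlockDecomposition.tendsto_sum {f : BlockSpace q t β} {c : ℕ → ℂ} {r : ℕ → ℝ}
    {b : ℕ → (Fin n → ℝ) → ℂ} (h : IsBlockDecomposition q t β f.1 c r b)
    {u : ℕ → BlockSpace q t β}
    (hu : ∀ j, (u j).1 =ᵐ[volume] dilate β (r j) (b j)) :
    Tendsto (fun J => ∑ j ∈ Finset.range J, c j • u j) atTop (𝓝 f) := by
  rw [tendsto_iff_norm_sub_tendsto_zero]
  have h0 := tendsto_sum_nat_add fun j => ‖c j‖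
  refine squeeze_zero (fun _ => norm_nonneg _) (fun J => ?_) h0
  rw [norm_sub_rev]
  have e : (f - ∑ j ∈ Finset.range J, c j • u j).1 =ᵐ[volume]
      fun x => f.1 x - ∑ j ∈ Finset.range J, c j * dilate β (r j) (b j) x := by
    filter_upwards [BlockSpace.coe_sub f (∑ j ∈ Finset.range J, c j • u j),
      BlockSpace.coe_sum (Finset.range J) c u hu] with x h1 h2
    rw [h1, h2]
  refine (blockNorm_le ((h.shift J).congr_ae e.symm)).trans (le_of_eq ?_)
  simp only [add_comm J]

theorem tendsto_scaledENorm_zero (hq : ∀ i, 1 ≤ q i) (hq' : ∀ i, q i ≠ ∞) (ht : ∀ i, 1 ≤ t i)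
    (ht' : ∀ i, t i ≠ ∞) {ι : Type} {l : Filter ι} [l.IsCountablyGenerated]
    {b : ι → (Fin n → ℝ) → ℂ} {B : (Fin n → ℝ) → ℝ≥0∞} (hb : ∀ m, Measurable (b m))
    (hB : Measurable B) (hbB : ∀ m x, ‖b m x‖ₑ ≤ B x) (hB' : amalgamENorm q t B ≠ ∞)
    (h : ∀ x, Tendsto (fun m => b m x) l (𝓝 0)) :
    Tendsto (fun m => scaledENorm 1 q t (b m)) l (𝓝 0) := by
  simp only [scaledENorm_one_eq]
  refine tendsto_amalgamENorm_zero hq hq' ht ht' (fun m => (hb m).enorm) hB hbB hB'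
    (Eventually.of_forall fun x => ?_)
  simpa using (h x).enorm

/-- Dominated convergence in the block space. -/
theorem BlockSpace.tendsto_of_dominated (hq : ∀ i, 1 ≤ q i) (hq' : ∀ i, q i ≠ ∞)
    (ht : ∀ i, 1 ≤ t i) (ht' : ∀ i, t i ≠ ∞) {ι : Type} {l : Filter ι} [l.IsCountablyGenerated]
    {b : ι → (Fin n → ℝ) → ℂ} {B : (Fin n → ℝ) → ℝ≥0∞} (hb : ∀ m, Measurable (b m))
    (hB : Measurable B) (hbB : ∀ m x, ‖b m x‖ₑ ≤ B x) (hB' : amalgamENorm q t B ≠ ∞)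
    (h : ∀ x, Tendsto (fun m => b m x) l (𝓝 0)) (hloc : ∀ m, LocallyIntegrable (b m))
    {r : ℝ} (hr : 0 < r) {u : ι → BlockSpace q t β} {u₀ : BlockSpace q t β}
    (hu : ∀ m, (fun x => (u m).1 x - u₀.1 x) =ᵐ[volume] dilate β r (b m)) :
    Tendsto u l (𝓝 u₀) := by
  rw [tendsto_iff_norm_sub_tendsto_zero]
  have hfin : ∀ m, scaledENorm 1 q t (b m) ≠ ∞ := fun m => by
    rw [scaledENorm_one_eq]
    exact ne_top_of_le_ne_top hB' (amalgamENorm_mono q t (hbB m))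
  refine squeeze_zero (fun _ => norm_nonneg _) (fun m => BlockSpace.norm_le_of_ae_eq_dilate hr
    (hloc m) (hfin m) ((BlockSpace.coe_sub _ _).trans (hu m))) ?_
  have h1 := tendsto_scaledENorm_zero hq hq' ht ht' hb hB hbB hB' h
  exact (ENNReal.tendsto_toReal ENNReal.zero_ne_top).comp h1

end blocks

/-! ### Part (i): the Hölder inequality for the pairing. -/

section pairing
variable {p s q t : Fin n → ℝ≥0∞} {α β : ℝ≥0∞} [Fact (∀ i, 1 ≤ p i)] [Fact (∀ i, 1 ≤ s i)]

theorem FofanaSpace.norm_eq (g : FofanaSpace p s α) : ‖g‖ = (fofanaENorm p s α g.1).toReal := rfl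

theorem integrable_mul_and_norm_integral_le (hpq : ∀ i, (p i)⁻¹ + (q i)⁻¹ = 1)
    (hst : ∀ i, (s i)⁻¹ + (t i)⁻¹ = 1) (hαβ : α⁻¹ + β⁻¹ = 1)
    (g : FofanaSpace p s α) (f : BlockSpace q t β) :
    Integrable (fun x : Fin n → ℝ => f.1 x * g.1 x) ∧
      ‖∫ x : Fin n → ℝ, f.1 x * g.1 x‖ ≤ ‖g‖ * ‖f‖ := by
  have hm : AEStronglyMeasurable fun x => f.1 x * g.1 x :=
    f.1.aestronglyMeasurable.mul g.1.aestronglyMeasurable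
  have key : ∀ c r b, IsBlockDecomposition q t β f.1 c r b →
      ∫⁻ x, ‖f.1 x * g.1 x‖ₑ ≤ ENNReal.ofReal (∑' j, ‖c j‖) * fofanaENorm p s α g.1 :=
    fun c r b h => h.lintegral_mul_le hpq hst hαβ f.1.aestronglyMeasurable g.1.measurable
  refine ⟨⟨hm, ?_⟩, ?_⟩
  · obtain ⟨c, r, b, h⟩ := f.2.2
    exact (key c r b h).trans_lt (ENNReal.mul_lt_top ENNReal.ofReal_lt_top g.2.2)
  -- The block norm is an infimum that need not be attained, so the bound is proved for each larger
  -- δ and δ is sent down to ‖f‖.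
  · have h1 : ∀ δ, ‖f‖ < δ → ‖∫ x : Fin n → ℝ, f.1 x * g.1 x‖ ≤ ‖g‖ * δ := fun δ hδ => by
      obtain ⟨c, r, b, h, hlt⟩ := exists_lt_of_blockNorm_lt f.2.2 hδ
      have h2 := ENNReal.toReal_mono (ENNReal.mul_ne_top ENNReal.ofReal_ne_top g.2.2.ne)
        ((enorm_integral_le_lintegral_enorm _).trans (key c r b h))
      rw [toReal_enorm, ENNReal.toReal_mul,
        ENNReal.toReal_ofReal (tsum_nonneg fun _ => norm_nonneg _), mul_comm] at h2
      exact h2.trans (mul_le_mul_of_nonneg_left hlt.le (norm_nonneg g))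
    have hc : Tendsto (fun δ => ‖g‖ * δ) (𝓝[>] ‖f‖) (𝓝 (‖g‖ * ‖f‖)) :=
      ((continuous_const.mul continuous_id).tendsto _).mono_left nhdsWithin_le_nhds
    exact ge_of_tendsto hc (eventually_mem_nhdsWithin.mono h1)

end pairing

/-! ### The density representing a functional on functions dominated by w. -/

section density
variable {q t : Fin n → ℝ≥0∞} {β : ℝ≥0∞} {w : (Fin n → ℝ) → ℝ≥0}

theorem locallyIntegrable_of_norm_le {φ : (Fin n → ℝ) → ℂ} (hφ : Measurable φ) {C : ℝ}
    (h : ∀ x, ‖φ x‖ ≤ C) : LocallyIntegrable φ :=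
  (locallyIntegrable_const C).mono hφ.aestronglyMeasurable
    (Eventually.of_forall fun x => (h x).trans (le_abs_self C))

theorem amalgamENorm_const_mul_weight_ne_top (hwA : amalgamENorm q t (fun x => w x) ≤ 1) (C : ℝ≥0) :
    amalgamENorm q t (fun x => C * w x) ≠ ∞ := by
  have e : amalgamENorm q t (fun x => C * w x) = C * amalgamENorm q t (fun x => w x) := by
    unfold amalgamENorm
    rw [← mixedENorm_const_mul t ENNReal.coe_ne_top]
    congr 1
    funext k
    rw [← mixedENorm_const_mul q ENNReal.coe_ne_top]
    congr 1
    funext x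
    by_cases hx : x ∈ cube 1 k <;> simp [hx]
  rw [e]
  exact ENNReal.mul_ne_top ENNReal.coe_ne_top (ne_top_of_le_ne_top ENNReal.one_ne_top hwA)

theorem enorm_le_of_norm_le_mul {z : ℂ} {C a : ℝ≥0} (h : ‖z‖ ≤ C * a) : ‖z‖ₑ ≤ C * a := by
  have h1 : ‖z‖₊ ≤ C * a := by exact_mod_cast h
  have : (‖z‖₊ : ℝ≥0∞) ≤ ((C * a : ℝ≥0) : ℝ≥0∞) := by exact_mod_cast h1
  simpa [enorm] using this

theorem exists_block_of_norm_le_weight (hw1 : ∀ x, w x ≤ 1)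
    (hwA : amalgamENorm q t (fun x => w x) ≤ 1) {φ : (Fin n → ℝ) → ℂ} (hφ : Measurable φ)
    {C : ℝ≥0} (h : ∀ x, ‖φ x‖ ≤ C * w x) : ∃ u : BlockSpace q t β, u.1 =ᵐ[volume] φ := by
  have hloc : LocallyIntegrable φ := locallyIntegrable_of_norm_le hφ (C := C) fun x =>
    (h x).trans (mul_le_of_le_one_right C.2 (hw1 x))
  have hfin : scaledENorm 1 q t φ ≠ ∞ := by
    rw [scaledENorm_one_eq]
    exact ne_top_of_le_ne_top (amalgamENorm_const_mul_weight_ne_top hwA C)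
      (amalgamENorm_mono q t fun x => enorm_le_of_norm_le_mul (h x))
  refine ⟨BlockSpace.ofDilate one_pos hloc hfin, ?_⟩
  have := BlockSpace.coe_ofDilate (β := β) one_pos hloc hfin
  rwa [dilate_one] at this

/-- Dominated convergence at scale r = 1, with majorant 2 C w for the differences. -/
theorem BlockSpace.tendsto_of_le_weight (hq : ∀ i, 1 ≤ q i) (hq' : ∀ i, q i ≠ ∞)
    (ht : ∀ i, 1 ≤ t i) (ht' : ∀ i, t i ≠ ∞) (hw : Measurable w) (hw1 : ∀ x, w x ≤ 1)
    (hwA : amalgamENorm q t (fun x => w x) ≤ 1) {ι : Type} {l : Filter ι} [l.IsCountablyGenerated]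
    {φ : ι → (Fin n → ℝ) → ℂ} {φ₀ : (Fin n → ℝ) → ℂ} (hφ : ∀ m, Measurable (φ m))
    (hφ₀ : Measurable φ₀) {C : ℝ≥0} (hC : ∀ m x, ‖φ m x‖ ≤ C * w x)
    (hC₀ : ∀ x, ‖φ₀ x‖ ≤ C * w x) (h : ∀ x, Tendsto (fun m => φ m x) l (𝓝 (φ₀ x)))
    {u : ι → BlockSpace q t β} {u₀ : BlockSpace q t β} (hu : ∀ m, (u m).1 =ᵐ[volume] φ m)
    (hu₀ : u₀.1 =ᵐ[volume] φ₀) : Tendsto u l (𝓝 u₀) := by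
  have hb : ∀ m x, ‖φ m x - φ₀ x‖ ≤ (2 * C : ℝ≥0) * w x := fun m x => by
    refine (norm_sub_le _ _).trans ((add_le_add (hC m x) (hC₀ x)).trans (le_of_eq ?_))
    push_cast
    ring
  refine BlockSpace.tendsto_of_dominated hq hq' ht ht' (b := fun m x => φ m x - φ₀ x)
    (B := fun x => (2 * C : ℝ≥0) * w x) (fun m => (hφ m).sub hφ₀)
    (hw.coe_nnreal_ennreal.const_mul _) (fun m x => enorm_le_of_norm_le_mul (hb m x))
    (amalgamENorm_const_mul_weight_ne_top hwA _) (fun x => ?_)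
    (fun m => locallyIntegrable_of_norm_le ((hφ m).sub hφ₀) (C := (2 * C : ℝ≥0)) fun x =>
      (hb m x).trans (mul_le_of_le_one_right (2 * C : ℝ≥0).2 (hw1 x)))
    one_pos (fun m => ?_)
  · simpa using (h x).sub_const (φ₀ x)
  · rw [dilate_one]
    filter_upwards [hu m, hu₀] with x h1 h2
    rw [h1, h2]

/-- A complex measure that is absolutely continuous with respect to a `σ`-finite measure has an
integrable density. -/
theorem exists_integrable_density {X : Type} [MeasurableSpace X] {μ : Measure X} [SigmaFinite μ]
    (ν : ComplexMeasure X) (hν : ∀ E, μ E = 0 → ν E = 0) :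
    ∃ h : X → ℂ, Measurable h ∧ Integrable h μ ∧
      ∀ E, MeasurableSet E → ν E = ∫ x in E, h x ∂μ := by
  have hre : (ComplexMeasure.re ν) ≪ᵥ μ.toENNRealVectorMeasure :=
    VectorMeasure.AbsolutelyContinuous.mk fun E hE h0 => by
      rw [Measure.toENNRealVectorMeasure_apply_measurable hE] at h0
      change (ν E).re = 0
      rw [hν E h0, Complex.zero_re]
  have him : (ComplexMeasure.im ν) ≪ᵥ μ.toENNRealVectorMeasure :=
    VectorMeasure.AbsolutelyContinuous.mk fun E hE h0 => by
      rw [Measure.toENNRealVectorMeasure_apply_measurable hE] at h0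
      change (ν E).im = 0
      rw [hν E h0, Complex.zero_im]
  set a := (ComplexMeasure.re ν).rnDeriv μ
  set b := (ComplexMeasure.im ν).rnDeriv μ
  have ha : Integrable a μ := SignedMeasure.integrable_rnDeriv _ _
  have hb : Integrable b μ := SignedMeasure.integrable_rnDeriv _ _
  have ha' : μ.withDensityᵥ a = ComplexMeasure.re ν := SignedMeasure.withDensityᵥ_rnDeriv_eq _ _ hre
  have hb' : μ.withDensityᵥ b = ComplexMeasure.im ν := SignedMeasure.withDensityᵥ_rnDeriv_eq _ _ him
  refine ⟨fun x => a x + b x * Complex.I, ?_, ha.ofReal.add (hb.ofReal.mul_const _), fun E hE => ?_⟩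
  · exact (Complex.measurable_ofReal.comp (SignedMeasure.measurable_rnDeriv _ _)).add
      ((Complex.measurable_ofReal.comp (SignedMeasure.measurable_rnDeriv _ _)).mul_const _)
  · have e1 : (ν E).re = ∫ x in E, a x ∂μ := by
      rw [← withDensityᵥ_apply ha hE, ha']
      rfl
    have e2 : (ν E).im = ∫ x in E, b x ∂μ := by
      rw [← withDensityᵥ_apply hb hE, hb']
      rfl
    rw [integral_add ha.ofReal.restrict (hb.ofReal.mul_const _).restrict,
      integral_mul_const, integral_complex_ofReal, integral_complex_ofReal, ← e1, ← e2,
      Complex.re_add_im]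

/-- A continuous functional on the block space is given by an integrable density on multiples of
indicators of a weight. -/
theorem exists_density_indicator (hq : ∀ i, 1 ≤ q i) (hq' : ∀ i, q i ≠ ∞)
    (ht : ∀ i, 1 ≤ t i) (ht' : ∀ i, t i ≠ ∞) (hw : Measurable w) (hw1 : ∀ x, w x ≤ 1)
    (hwA : amalgamENorm q t (fun x => w x) ≤ 1) (L : StrongDual ℂ (BlockSpace q t β)) :
    ∃ h : (Fin n → ℝ) → ℂ, Measurable h ∧ Integrable h ∧ ∀ E, MeasurableSet E →
      ∀ u : BlockSpace q t β, u.1 =ᵐ[volume] E.indicator (fun x => ((w x : ℝ) : ℂ)) →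
        L u = ∫ x in E, h x := by
  have hwC : Measurable fun x => ((w x : ℝ) : ℂ) :=
    Complex.measurable_ofReal.comp hw.coe_nnreal_real
  have hbd : ∀ E : Set (Fin n → ℝ), ∀ x,
      ‖E.indicator (fun x => ((w x : ℝ) : ℂ)) x‖ ≤ (1 : ℝ≥0) * w x := fun E x => by
    refine (norm_indicator_le_norm_self _ _).trans (le_of_eq ?_)
    simp
  have hex : ∀ E : Set (Fin n → ℝ), MeasurableSet E → ∃ u : BlockSpace q t β,
      u.1 =ᵐ[volume] E.indicator (fun x => ((w x : ℝ) : ℂ)) := fun E hE =>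
    exists_block_of_norm_le_weight hw1 hwA (hwC.indicator hE) (hbd E)
  choose U hU using hex
  have hU' : ∀ E (hE : MeasurableSet E) (u : BlockSpace q t β),
      u.1 =ᵐ[volume] E.indicator (fun x => ((w x : ℝ) : ℂ)) → u = U E hE := fun E hE u hu =>
    BlockSpace.ext_ae (hu.trans (hU E hE).symm)
  classical
  set I : Set (Fin n → ℝ) → ℂ := fun E => if hE : MeasurableSet E then L (U E hE) else 0 with hI
  have hIE : ∀ E (hE : MeasurableSet E), I E = L (U E hE) := fun E hE => dif_pos hE
  have hnull : ∀ E, volume E = 0 → I E = 0 := fun E hE0 => by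
    by_cases hE : MeasurableSet E
    · rw [hIE E hE, ← map_zero L]
      congr 1
      refine (hU' E hE 0 ?_).symm
      have h0 : ∀ᵐ x, x ∉ E := measure_eq_zero_iff_ae_notMem.1 hE0
      have hz : (0 : BlockSpace q t β).1 =ᵐ[volume] 0 := AEEqFun.coeFn_zero
      filter_upwards [h0, hz] with x hx hx'
      rw [hx', Set.indicator_of_notMem hx, Pi.zero_apply]
    · exact dif_neg hE
  have hadd : ∀ A B, MeasurableSet A → MeasurableSet B → Disjoint A B →
      I (A ∪ B) = I A + I B := fun A B hA hB hAB => by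
    rw [hIE _ (hA.union hB), hIE A hA, hIE B hB, ← map_add]
    congr 1
    refine (hU' _ _ _ ?_).symm
    filter_upwards [BlockSpace.coe_add (U A hA) (U B hB), hU A hA, hU B hB] with x h1 h2 h3
    rw [h1, h2, h3, Set.indicator_union_of_disjoint hAB]
  have hempty : I ∅ = 0 := hnull ∅ measure_empty
  let ν : ComplexMeasure (Fin n → ℝ) :=
    { measureOf' := I
      empty' := hempty
      not_measurable' := fun E hE => dif_neg hE
      m_iUnion' := fun f hf hdisj => by
        have hS : ∀ S : Finset ℕ, MeasurableSet (⋃ i ∈ S, f i) := fun S =>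
          S.measurableSet_biUnion fun i _ => hf i
        have hsum : ∀ S : Finset ℕ, ∑ i ∈ S, I (f i) = I (⋃ i ∈ S, f i) := fun S => by
          induction S using Finset.induction_on with
          | empty => simp [hempty]
          | insert a S ha ih =>
            rw [Finset.sum_insert ha, ih, Finset.set_biUnion_insert, hadd _ _ (hf a) (hS S)]
            refine Set.disjoint_iUnion₂_right.2 fun i hi => hdisj ?_
            rintro rfl
            exact ha hi
        change Tendsto (fun S : Finset ℕ => ∑ i ∈ S, I (f i)) atTop (𝓝 (I (⋃ i, f i)))
        simp only [hsum, hIE _ (hS _), hIE _ (MeasurableSet.iUnion hf)]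
        -- Countable additivity is continuity of L along the finite unions: their indicators times w
        -- converge pointwise and are all dominated by w.
        refine (L.continuous.tendsto _).comp (BlockSpace.tendsto_of_le_weight hq hq' ht ht' hw hw1
          hwA (fun S => hwC.indicator (hS S)) (hwC.indicator (MeasurableSet.iUnion hf))
          (fun S => hbd _) (hbd _) (fun x => ?_) (fun S => hU _ _) (hU _ _))
        by_cases hx : x ∈ ⋃ i, f i
        · obtain ⟨i, hi⟩ := Set.mem_iUnion.1 hx
          refine tendsto_const_nhds.congr' ?_
          filter_upwards [eventually_ge_atTop {i}] with S hSi
          rw [Set.indicator_of_mem hx, Set.indicator_of_mem]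
          exact Set.mem_biUnion (Finset.singleton_subset_iff.1 hSi) hi
        · refine tendsto_const_nhds.congr fun S => ?_
          rw [Set.indicator_of_notMem hx, Set.indicator_of_notMem]
          exact fun h => hx (Set.iUnion₂_subset_iUnion _ _ h) }
  obtain ⟨h, hm, hint, hh⟩ := exists_integrable_density (μ := volume) ν hnull
  refine ⟨h, hm, hint, fun E hE u hu => ?_⟩
  rw [← hh E hE, hU' E hE u hu]
  exact (hIE E hE).symm

/-- Linearity extends the formula from indicators to simple functions φ. A bounded φ is a pointwise
limit of uniformly bounded simple functions, and both sides pass to the limit: L by domination by C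
w, the integral by domination by C |h|. -/
theorem exists_density (hq : ∀ i, 1 ≤ q i) (hq' : ∀ i, q i ≠ ∞)
    (ht : ∀ i, 1 ≤ t i) (ht' : ∀ i, t i ≠ ∞) (hw : Measurable w) (hw1 : ∀ x, w x ≤ 1)
    (hwA : amalgamENorm q t (fun x => w x) ≤ 1) (L : StrongDual ℂ (BlockSpace q t β)) :
    ∃ h : (Fin n → ℝ) → ℂ, Measurable h ∧ Integrable h ∧ ∀ φ : (Fin n → ℝ) → ℂ, Measurable φ →
      ∀ C : ℝ≥0, (∀ x, ‖φ x‖ ≤ C) → ∀ u : BlockSpace q t β,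
        u.1 =ᵐ[volume] (fun x => φ x * (w x : ℝ)) → L u = ∫ x, φ x * h x := by
  obtain ⟨h, hm, hint, hh⟩ := exists_density_indicator hq hq' ht ht' hw hw1 hwA L
  have hwC : Measurable fun x => ((w x : ℝ) : ℂ) :=
    Complex.measurable_ofReal.comp hw.coe_nnreal_real
  have hbd : ∀ {φ : (Fin n → ℝ) → ℂ} {C : ℝ≥0}, (∀ x, ‖φ x‖ ≤ C) →
      ∀ x, ‖φ x * (w x : ℝ)‖ ≤ C * w x := fun {φ C} hC x => by
    rw [norm_mul, Complex.norm_real, Real.norm_of_nonneg (w x).coe_nonneg]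
    exact mul_le_mul_of_nonneg_right (hC x) (w x).coe_nonneg
  have hex : ∀ φ : (Fin n → ℝ) → ℂ, Measurable φ → ∀ C : ℝ≥0, (∀ x, ‖φ x‖ ≤ C) →
      ∃ u : BlockSpace q t β, u.1 =ᵐ[volume] fun x => φ x * (w x : ℝ) := fun φ hφ C hC =>
    exists_block_of_norm_le_weight hw1 hwA (hφ.mul hwC) (hbd hC)
  have hexs : ∀ φ : SimpleFunc (Fin n → ℝ) ℂ,
      ∃ u : BlockSpace q t β, u.1 =ᵐ[volume] fun x => φ x * (w x : ℝ) := fun φ => by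
    obtain ⟨C, hC⟩ := φ.exists_forall_norm_le
    exact hex φ φ.measurable C.toNNReal fun x => (hC x).trans (Real.le_coe_toNNReal C)
  have hints : ∀ φ : SimpleFunc (Fin n → ℝ) ℂ, Integrable fun x => φ x * h x := fun φ => by
    obtain ⟨C, hC⟩ := φ.exists_forall_norm_le
    exact hint.bdd_mul φ.measurable.aestronglyMeasurable (Eventually.of_forall hC)
  have hsimple : ∀ φ : SimpleFunc (Fin n → ℝ) ℂ, ∀ u : BlockSpace q t β,
      u.1 =ᵐ[volume] (fun x => φ x * (w x : ℝ)) → L u = ∫ x, φ x * h x := by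
    intro φ
    induction φ using SimpleFunc.induction with
    | @const c E hE =>
      intro u hu
      obtain ⟨v, hv⟩ := exists_block_of_norm_le_weight (β := β) hw1 hwA (hwC.indicator hE) (C := 1)
        fun x => (norm_indicator_le_norm_self _ _).trans (by simp)
      have e : u = c • v := BlockSpace.ext_ae (by
        filter_upwards [hu, BlockSpace.coe_smul c v, hv] with x h1 h2 h3
        rw [h1, h2, h3]
        by_cases hx : x ∈ E <;> simp [hx])
      rw [e, map_smul, hh E hE v hv, smul_eq_mul, ← integral_const_mul, ← integral_indicator hE]
      refine integral_congr_ae (Eventually.of_forall fun x => ?_)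
      by_cases hx : x ∈ E <;> simp [hx]
    | @add f g _ hf hg =>
      intro u hu
      obtain ⟨v₁, hv₁⟩ := hexs f
      obtain ⟨v₂, hv₂⟩ := hexs g
      have e : u = v₁ + v₂ := BlockSpace.ext_ae (by
        filter_upwards [hu, BlockSpace.coe_add v₁ v₂, hv₁, hv₂] with x h1 h2 h3 h4
        rw [h1, h2, h3, h4, SimpleFunc.coe_add, Pi.add_apply, add_mul])
      rw [e, map_add, hf v₁ hv₁, hg v₂ hv₂, ← integral_add (hints f) (hints g)]
      refine integral_congr_ae (Eventually.of_forall fun x => ?_)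
      simp [add_mul]
  refine ⟨h, hm, hint, fun φ hφ C hC u hu => ?_⟩
  have hφs := hφ.stronglyMeasurable
  have hlim : ∀ x, Tendsto (fun m => hφs.approxBounded C m x) atTop (𝓝 (φ x)) := fun x =>
    hφs.tendsto_approxBounded_of_norm_le (hC x)
  have hle : ∀ m x, ‖hφs.approxBounded C m x‖ ≤ C := fun m x =>
    hφs.norm_approxBounded_le C.2 m x
  choose v hv using fun m => hexs (hφs.approxBounded C m)
  have t1 : Tendsto (fun m => L (v m)) atTop (𝓝 (L u)) :=
    (L.continuous.tendsto _).comp (BlockSpace.tendsto_of_le_weight hq hq' ht ht' hw hw1 hwA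
      (fun m => (hφs.approxBounded C m).measurable.mul hwC) (hφ.mul hwC) (fun m => hbd (hle m))
      (hbd hC) (fun x => (hlim x).mul_const _) hv hu)
  have t2 : Tendsto (fun m => ∫ x, hφs.approxBounded C m x * h x) atTop
      (𝓝 (∫ x, φ x * h x)) := by
    refine tendsto_integral_of_dominated_convergence (fun x => C * ‖h x‖)
      (fun m => (hints _).aestronglyMeasurable) (hint.norm.const_mul _)
      (fun m => Eventually.of_forall fun x => ?_)
      (Eventually.of_forall fun x => (hlim x).mul_const _)
    rw [norm_mul]
    exact mul_le_mul_of_nonneg_right (hle m x) (norm_nonneg _)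
  refine tendsto_nhds_unique t1 (t2.congr fun m => ?_)
  exact (hsimple _ _ (hv m)).symm

end density

/-! ### Part (ii): isometry and surjectivity. -/

section duality
variable {p s q t : Fin n → ℝ≥0∞} {α β : ℝ≥0∞} [hp : Fact (∀ i, 1 ≤ p i)]
  [hs : Fact (∀ i, 1 ≤ s i)]

/-- The functional `f ↦ ∫ f g` on the block space. -/
noncomputable def pairing (hpq : ∀ i, (p i)⁻¹ + (q i)⁻¹ = 1) (hst : ∀ i, (s i)⁻¹ + (t i)⁻¹ = 1)
    (hαβ : α⁻¹ + β⁻¹ = 1) (g : FofanaSpace p s α) : StrongDual ℂ (BlockSpace q t β) :=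
  LinearMap.mkContinuous
    { toFun := fun f => ∫ x : Fin n → ℝ, f.1 x * g.1 x
      map_add' := fun u v => by
        rw [← integral_add (integrable_mul_and_norm_integral_le hpq hst hαβ g u).1
          (integrable_mul_and_norm_integral_le hpq hst hαβ g v).1]
        refine integral_congr_ae ?_
        filter_upwards [BlockSpace.coe_add u v] with x hx
        rw [hx, add_mul]
      map_smul' := fun a u => by
        rw [RingHom.id_apply, smul_eq_mul, ← integral_const_mul]
        refine integral_congr_ae ?_
        filter_upwards [BlockSpace.coe_smul a u] with x hx
        rw [hx, mul_assoc] }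
    ‖g‖ fun f => (integrable_mul_and_norm_integral_le hpq hst hαβ g f).2

theorem pairing_apply (hpq : ∀ i, (p i)⁻¹ + (q i)⁻¹ = 1) (hst : ∀ i, (s i)⁻¹ + (t i)⁻¹ = 1)
    (hαβ : α⁻¹ + β⁻¹ = 1) (g : FofanaSpace p s α) (f : BlockSpace q t β) :
    pairing hpq hst hαβ g f = ∫ x : Fin n → ℝ, f.1 x * g.1 x := rfl

/-- Explains the bound w(r y) imposed on test blocks: after dilation by r it becomes a multiple of w
itself, whatever r is. -/
theorem dilate_mul_weight_le {w : (Fin n → ℝ) → ℝ≥0} {r : ℝ} (hr : 0 < r)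
    {b : (Fin n → ℝ) → ℂ} {m : ℕ} (hb : ∀ y, ‖b y‖ ≤ m * w (r • y)) (x : Fin n → ℝ) :
    ‖dilate β r b x‖ ≤ (r ^ (-((n : ℝ) * β⁻¹.toReal)) * m).toNNReal * w x := by
  rw [Real.coe_toNNReal _ (by positivity), dilate, norm_mul, Complex.norm_real,
    Real.norm_of_nonneg (by positivity), mul_assoc]
  have := hb (r⁻¹ • x)
  rw [smul_inv_smul₀ hr.ne'] at this
  gcongr

theorem measurable_dilate (β : ℝ≥0∞) (r : ℝ) {b : (Fin n → ℝ) → ℂ} (hb : Measurable b) :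
    Measurable (dilate β r b) :=
  (hb.comp (measurable_const_smul r⁻¹)).const_mul _

theorem norm_pairing (hpq : ∀ i, (p i)⁻¹ + (q i)⁻¹ = 1) (hst : ∀ i, (s i)⁻¹ + (t i)⁻¹ = 1)
    (hαβ : α⁻¹ + β⁻¹ = 1) (g : FofanaSpace p s α) :
    ‖(pairing hpq hst hαβ g : StrongDual ℂ (BlockSpace q t β))‖ = ‖g‖ := by
  refine le_antisymm (LinearMap.mkContinuous_norm_le _ (norm_nonneg g) _) ?_
  rw [FofanaSpace.norm_eq]
  refine ENNReal.toReal_le_of_le_ofReal (norm_nonneg _) ?_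
  -- Here g is already given, so the constant weight 1 suffices: it makes the test blocks bounded,
  -- hence locally integrable.
  refine fofanaENorm_le_of_forall_pairing_le hpq hst hαβ g.1.measurable
    (v := fun _ => 1) measurable_const (fun _ => one_pos) fun r hr b hb m hbm hb1 => ?_
  have hloc : LocallyIntegrable b := locallyIntegrable_of_norm_le hb (C := m) (by simpa using hbm)
  have hfin : scaledENorm 1 q t b ≠ ∞ := ne_top_of_le_ne_top ENNReal.one_ne_top hb1
  set u : BlockSpace q t β := BlockSpace.ofDilate hr hloc hfin
  have hu : u.1 =ᵐ[volume] dilate β r b := BlockSpace.coe_ofDilate hr hloc hfin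
  have he : (fun x => u.1 x * g.1 x) =ᵐ[volume] fun x => dilate β r b x * g.1 x := by
    filter_upwards [hu] with x hx
    rw [hx]
  refine ⟨(integrable_mul_and_norm_integral_le hpq hst hαβ g u).1.congr he, ?_⟩
  rw [← integral_congr_ae he, ← pairing_apply hpq hst hαβ g u, ← ofReal_norm]
  refine ENNReal.ofReal_le_ofReal ((ContinuousLinearMap.le_opNorm _ u).trans ?_)
  refine mul_le_of_le_one_right (norm_nonneg _)
    ((BlockSpace.norm_le_of_ae_eq_dilate hr hloc hfin hu).trans ?_)
  simpa using ENNReal.toReal_mono ENNReal.one_ne_top hb1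

/-- Two functionals agree if they agree on the dilates of all functions dominated by a multiple of a
dilate of a positive weight. -/
theorem dual_ext (hq : ∀ i, 1 ≤ q i) (hq' : ∀ i, q i ≠ ∞) (ht : ∀ i, 1 ≤ t i)
    (ht' : ∀ i, t i ≠ ∞) {w : (Fin n → ℝ) → ℝ≥0} (hw : Measurable w) (hw0 : ∀ x, 0 < w x)
    {L M : StrongDual ℂ (BlockSpace q t β)}
    (H : ∀ r : ℝ, 0 < r → ∀ b : (Fin n → ℝ) → ℂ, Measurable b → ∀ m : ℕ,
      (∀ y, ‖b y‖ ≤ m * w (r • y)) → ∀ u : BlockSpace q t β, u.1 =ᵐ[volume] dilate β r b →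
      L u = M u) : L = M := by
  have hdil : ∀ (r : ℝ) (hr : 0 < r) (b : (Fin n → ℝ) → ℂ), LocallyIntegrable b →
      scaledENorm 1 q t b ≠ ∞ → ∀ u : BlockSpace q t β, u.1 =ᵐ[volume] dilate β r b →
      L u = M u := by
    intro r hr b' hloc' hfin' u hu'
    obtain ⟨b, hb, hbb'⟩ : ∃ b : (Fin n → ℝ) → ℂ, Measurable b ∧ b' =ᵐ[volume] b :=
      ⟨_, hloc'.aestronglyMeasurable.stronglyMeasurable_mk.measurable,
        hloc'.aestronglyMeasurable.ae_eq_mk⟩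
    have hloc : LocallyIntegrable b := hloc'.congr hbb'
    have hfin : scaledENorm 1 q t b ≠ ∞ := by rwa [← scaledENorm_congr_ae 1 q t hbb']
    have hu := hu'.trans (dilate_congr_ae β hr hbb')
    -- Since w > 0, every point lies in S m for all large m. The truncations of b to S m therefore
    -- converge to b pointwise, dominated by |b|.
    set S : ℕ → Set (Fin n → ℝ) := fun m => {y | ‖b y‖ ≤ m * w (r • y)} with hS
    have hSm : ∀ m, MeasurableSet (S m) := fun m => measurableSet_le hb.norm
      ((hw.comp (measurable_const_smul r)).coe_nnreal_real.const_mul _)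
    have hlocS : ∀ m, LocallyIntegrable ((S m).indicator b) := fun m => hloc.indicator (hSm m)
    have hfinS : ∀ m, scaledENorm 1 q t ((S m).indicator b) ≠ ∞ := fun m => by
      rw [scaledENorm_one_eq] at hfin ⊢
      exact ne_top_of_le_ne_top hfin (amalgamENorm_mono q t fun x =>
        enorm_indicator_le_enorm_self _ _)
    set v : ℕ → BlockSpace q t β := fun m => BlockSpace.ofDilate hr (hlocS m) (hfinS m)
    have hv : ∀ m, (v m).1 =ᵐ[volume] dilate β r ((S m).indicator b) := fun m =>
      BlockSpace.coe_ofDilate hr (hlocS m) (hfinS m)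
    have hLM : ∀ m, L (v m) = M (v m) := fun m =>
      H r hr _ (hb.indicator (hSm m)) m (fun y => by
        by_cases hy : y ∈ S m
        · rw [Set.indicator_of_mem hy]; exact hy
        · rw [Set.indicator_of_notMem hy, norm_zero]; positivity) _ (hv m)
    have hlim : Tendsto v atTop (𝓝 u) := by
      rw [scaledENorm_one_eq] at hfin
      refine BlockSpace.tendsto_of_dominated hq hq' ht ht'
        (b := fun m => (S m).indicator b - b) (B := fun x => ‖b x‖ₑ)
        (fun m => (hb.indicator (hSm m)).sub hb) hb.enorm (fun m x => ?_) hfin (fun x => ?_)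
        (fun m => (hlocS m).sub hloc) hr (fun m => ?_)
      · by_cases hx : x ∈ S m <;> simp [hx]
      · refine tendsto_const_nhds.congr' ?_
        obtain ⟨N, hN⟩ := exists_nat_ge (‖b x‖ / w (r • x))
        filter_upwards [eventually_ge_atTop N] with m hm
        have hpos : (0 : ℝ) < w (r • x) := hw0 _
        have hx : x ∈ S m := by
          refine (div_le_iff₀ hpos).1 (hN.trans ?_)
          exact_mod_cast hm
        simp [hx]
      · filter_upwards [hv m, hu] with x h1 h2
        rw [h1, h2]
        simp only [dilate, Pi.sub_apply, mul_sub]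
    refine tendsto_nhds_unique ((L.continuous.tendsto u).comp hlim) ?_
    refine ((M.continuous.tendsto u).comp hlim).congr fun m => ?_
    exact (hLM m).symm
  refine ContinuousLinearMap.ext fun f => ?_
  obtain ⟨c, r, b, h⟩ := f.2.2
  have hfin : ∀ j, scaledENorm 1 q t (b j) ≠ ∞ := fun j =>
    ne_top_of_le_ne_top ENNReal.one_ne_top (h.norm_le j)
  set u : ℕ → BlockSpace q t β := fun j => BlockSpace.ofDilate (h.pos j) (h.locInt j) (hfin j)
  have hu : ∀ j, (u j).1 =ᵐ[volume] dilate β (r j) (b j) := fun j =>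
    BlockSpace.coe_ofDilate (h.pos j) (h.locInt j) (hfin j)
  have hlim := h.tendsto_sum hu
  refine tendsto_nhds_unique ((L.continuous.tendsto f).comp hlim) ?_
  refine ((M.continuous.tendsto f).comp hlim).congr fun J => ?_
  simp only [Function.comp, map_sum, map_smul]
  exact Finset.sum_congr rfl fun j _ => by
    rw [hdil (r j) (h.pos j) (b j) (h.locInt j) (hfin j) (u j) (hu j)]

/-- The candidate is g = h / w with h the density of L relative to w. It is locally integrable
because w is locally bounded below, and its norm is at most ‖L‖ because the almost norming blocks
lie where L is integration against g. -/
theorem pairing_surjective (hpq : ∀ i, (p i)⁻¹ + (q i)⁻¹ = 1)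
    (hst : ∀ i, (s i)⁻¹ + (t i)⁻¹ = 1) (hαβ : α⁻¹ + β⁻¹ = 1)
    (hq' : ∀ i, q i ≠ ∞) (ht' : ∀ i, t i ≠ ∞) (L : StrongDual ℂ (BlockSpace q t β)) :
    ∃ g : FofanaSpace p s α, pairing hpq hst hαβ g = L := by
  have hq : ∀ i, 1 ≤ q i := fun i => one_le_of_conjugate (hpq i)
  have ht : ∀ i, 1 ≤ t i := fun i => one_le_of_conjugate (hst i)
  obtain ⟨w, hw, hw0, hw1, hwloc, hwA⟩ := exists_weight q ht
  obtain ⟨h, hm, hint, hh⟩ := exists_density hq hq' ht ht' hw hw1 hwA L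
  have hwC : Measurable fun x => ((w x : ℝ) : ℂ) :=
    Complex.measurable_ofReal.comp hw.coe_nnreal_real
  have hwC0 : ∀ x, ((w x : ℝ) : ℂ) ≠ 0 := fun x => by exact_mod_cast (hw0 x).ne'
  set g : (Fin n → ℝ) → ℂ := fun x => h x / (w x : ℝ) with hg
  have hgm : Measurable g := hm.div hwC
  have hLg : ∀ f : (Fin n → ℝ) → ℂ, Measurable f → ∀ C : ℝ≥0, (∀ x, ‖f x‖ ≤ C * w x) →
      Integrable (fun x => f x * g x) ∧ ∀ u : BlockSpace q t β, u.1 =ᵐ[volume] f →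
        L u = ∫ x, f x * g x := by
    intro f hf C hC
    have hφ : ∀ x, ‖f x / (w x : ℝ)‖ ≤ C := fun x => by
      rw [norm_div, Complex.norm_real, Real.norm_of_nonneg (w x).coe_nonneg,
        div_le_iff₀ (by exact_mod_cast hw0 x)]
      exact hC x
    have e : ∀ x, f x * g x = f x / (w x : ℝ) * h x := fun x => by
      simp only [hg]
      ring
    simp only [e]
    refine ⟨hint.bdd_mul (hf.div hwC).aestronglyMeasurable (Eventually.of_forall hφ),
      fun u hu => hh _ (hf.div hwC) C hφ u ?_⟩
    filter_upwards [hu] with x hx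
    rw [hx, Pi.div_apply, div_mul_cancel₀ _ (hwC0 x)]
  have hgloc : LocallyIntegrable g := by
    intro x
    obtain ⟨δ, hδ, hev⟩ := hwloc x
    refine ⟨{y | δ ≤ w y}, hev, ?_⟩
    refine Integrable.mono' ((hint.norm.const_mul (δ⁻¹ : ℝ)).integrableOn)
      hgm.aestronglyMeasurable ?_
    rw [ae_restrict_iff' (measurableSet_le measurable_const hw)]
    refine Eventually.of_forall fun y hy => ?_
    have hy' : (δ : ℝ) ≤ w y := by exact_mod_cast hy
    have hδ' : (0 : ℝ) < δ := by exact_mod_cast hδ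
    simp only [hg]
    rw [norm_div, Complex.norm_real, Real.norm_of_nonneg (w y).coe_nonneg, div_eq_inv_mul]
    gcongr
  have hbound : fofanaENorm p s α g ≤ ENNReal.ofReal ‖L‖ := by
    refine fofanaENorm_le_of_forall_pairing_le hpq hst hαβ hgm hw hw0 fun r hr b hb m hbm hb1 => ?_
    obtain ⟨h1, h2⟩ := hLg (dilate β r b) (measurable_dilate β r hb) _ (dilate_mul_weight_le hr hbm)
    refine ⟨h1, ?_⟩
    have hloc : LocallyIntegrable b := locallyIntegrable_of_norm_le hb (C := m) fun y =>
      (hbm y).trans (mul_le_of_le_one_right (Nat.cast_nonneg m) (hw1 _))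
    have hfin : scaledENorm 1 q t b ≠ ∞ := ne_top_of_le_ne_top ENNReal.one_ne_top hb1
    set u : BlockSpace q t β := BlockSpace.ofDilate hr hloc hfin
    have hu : u.1 =ᵐ[volume] dilate β r b := BlockSpace.coe_ofDilate hr hloc hfin
    rw [← h2 u hu, ← ofReal_norm]
    refine ENNReal.ofReal_le_ofReal ((L.le_opNorm u).trans ?_)
    refine mul_le_of_le_one_right (norm_nonneg _)
      ((BlockSpace.norm_le_of_ae_eq_dilate hr hloc hfin hu).trans ?_)
    simpa using ENNReal.toReal_mono ENNReal.one_ne_top hb1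
  have hcoe : AEEqFun.mk g hgm.aestronglyMeasurable =ᵐ[volume] g := AEEqFun.coeFn_mk _ _
  refine ⟨⟨AEEqFun.mk g hgm.aestronglyMeasurable, hgloc.congr hcoe.symm, ?_⟩, ?_⟩
  · rw [fofanaENorm_congr_ae p s α hcoe]
    exact hbound.trans_lt ENNReal.ofReal_lt_top
  · refine dual_ext hq hq' ht ht' hw hw0 fun r hr b hb m hbm u hu => ?_
    rw [(hLg (dilate β r b) (measurable_dilate β r hb) _ (dilate_mul_weight_le hr hbm)).2 u hu,
      pairing_apply]
    refine integral_congr_ae ?_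
    filter_upwards [hu, hcoe] with x h1 h2
    rw [h1, h2]

/-- The pairing as an isometric isomorphism onto the dual of the block space. -/
noncomputable def pairingEquiv (hpq : ∀ i, (p i)⁻¹ + (q i)⁻¹ = 1)
    (hst : ∀ i, (s i)⁻¹ + (t i)⁻¹ = 1) (hαβ : α⁻¹ + β⁻¹ = 1)
    (hq' : ∀ i, q i ≠ ∞) (ht' : ∀ i, t i ≠ ∞) :
    FofanaSpace p s α ≃ₗᵢ[ℂ] StrongDual ℂ (BlockSpace q t β) :=
  LinearIsometryEquiv.ofSurjective
    { toFun := pairing hpq hst hαβ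
      map_add' := fun g g' => ContinuousLinearMap.ext fun f => by
        rw [add_apply, pairing_apply, pairing_apply, pairing_apply,
          ← integral_add (integrable_mul_and_norm_integral_le hpq hst hαβ g f).1
            (integrable_mul_and_norm_integral_le hpq hst hαβ g' f).1]
        refine integral_congr_ae ?_
        have : (g + g').1 =ᵐ[volume] fun x => g.1 x + g'.1 x := AEEqFun.coeFn_add g.1 g'.1
        filter_upwards [this] with x hx
        rw [hx, mul_add]
      map_smul' := fun a g => ContinuousLinearMap.ext fun f => by
        rw [RingHom.id_apply, smul_apply, pairing_apply, pairing_apply,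
          smul_eq_mul, ← integral_const_mul]
        refine integral_congr_ae ?_
        have : (a • g).1 =ᵐ[volume] fun x => a * g.1 x := AEEqFun.coeFn_smul a g.1
        filter_upwards [this] with x hx
        rw [hx, mul_left_comm]
      norm_map' := norm_pairing hpq hst hαβ }
    (pairing_surjective hpq hst hαβ hq' ht')

theorem ne_top_of_one_lt_conjugate {p q : ℝ≥0∞} (h : p⁻¹ + q⁻¹ = 1) (hp : 1 < p) : q ≠ ∞ := by
  rintro rfl
  rw [ENNReal.inv_top, add_zero, ENNReal.inv_eq_one] at h
  exact hp.ne' h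

end duality

end MixedAmalgam

/-- Duality between the block space `𝓗(p⃗', s⃗', α')` and `(L^{p⃗}, ℓ^{s⃗})^α(ℝⁿ)`. -/
theorem theorem2p7 {n : ℕ} (hn : 0 < n) (p s p' s' : Fin n → ℝ≥0∞) (α α' : ℝ≥0∞)
    [Fact (∀ i, 1 ≤ p i)] [Fact (∀ i, 1 ≤ s i)]
    (hp' : ∀ i, (p i)⁻¹ + (p' i)⁻¹ = 1) (hs' : ∀ i, (s i)⁻¹ + (s' i)⁻¹ = 1)
    (hα' : α⁻¹ + α'⁻¹ = 1)
    (hsα : (∑ i, (s i)⁻¹) / n ≤ α⁻¹) (hαp : α⁻¹ ≤ (∑ i, (p i)⁻¹) / n) :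
    (∀ (g : MixedAmalgam.FofanaSpace p s α) (f : MixedAmalgam.BlockSpace p' s' α'),
      Integrable (fun x : Fin n → ℝ => f.1 x * g.1 x) volume ∧
        ‖∫ x : Fin n → ℝ, f.1 x * g.1 x‖ ≤ ‖g‖ * ‖f‖) ∧
    ((∀ i, 1 < p i) → (∀ i, 1 < s i) →
      ∃ T : MixedAmalgam.FofanaSpace p s α ≃ₗᵢ[ℂ]
          StrongDual ℂ (MixedAmalgam.BlockSpace p' s' α'),
        ∀ (g : MixedAmalgam.FofanaSpace p s α) (f : MixedAmalgam.BlockSpace p' s' α'),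
          T g f = ∫ x : Fin n → ℝ, f.1 x * g.1 x) :=
  ⟨fun g f => MixedAmalgam.integrable_mul_and_norm_integral_le hp' hs' hα' g f, fun hp hs =>
    ⟨MixedAmalgam.pairingEquiv hp' hs' hα'
      (fun i => MixedAmalgam.ne_top_of_one_lt_conjugate (hp' i) (hp i))
      (fun i => MixedAmalgam.ne_top_of_one_lt_conjugate (hs' i) (hs i)), fun _ _ => rfl⟩⟩
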